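/- **Proposition 5.1.** Let $\alpha>0$ and $\sigma>0$, and let $\pi_{\alpha,\sigma}=e^{-\sigma/\alpha^2}\sum_{n=0}^\infty\frac1{n!}\left(\frac{\sigma}{\alpha^2}\right)^n\delta_{\alpha n}$, a probability measure on $\alpha\mathbb N_0=\{0,\alpha,2\alpha,\dots\}$. Let $(c_n)_{n\ge0}$ be the sequence of monic polynomials ($\deg c_n=n$) orthogonal with respect to $\pi_{\alpha,\sigma}$. Let $\mathbb F_\sigma(\mathbb C)$ be the Bargmann space of entire functions $f(z)=\sum_{n\ge0} f_nz^n$ with $\sum_{n\ge0}|f_n|^2\,n!\,\sigma^n<\infty$, with inner product $(f,g)=\sum_{n\ge0} f_n\overline{g_n}\,n!\,\sigma^n$. There is a unique unitary operator $\mathcal S:L^2(\alpha\mathbb N_0,\pi_{\alpha,\sigma})\to\mathbb F_\sigma(\mathbb C)$ such that $(\mathcal Sc_n)(z)=z^n$ for all $n\in\mathbb N_0$; it is called the generalized Segal–Bargmann transform. Let $\mathcal E^1_{\min}(\mathbb C)$ be the space of entire functions $f$ such that $\|f\|_n=\sup_{z\in\mathbb C}|f(z)|e^{-|z|/n}<\infty$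 for every integer $n\ge1$, with the Fréchet topology given by the norms $\|\cdot\|_n$, $n\ge1$. Then restricting functions to $\alpha\mathbb N_0$ defines an injective continuous linear map $\mathcal E^1_{\min}(\mathbb C)\to L^2(\alpha\mathbb N_0,\pi_{\alpha,\sigma})$. Moreover, when $\mathcal E^1_{\min}(\mathbb C)$ is regarded as a subspace of $L^2(\alpha\mathbb N_0,\pi_{\alpha,\sigma})$ through this map, the restriction of $\mathcal S$ to $\mathcal E^1_{\min}(\mathbb C)$ is a linear self-homeomorphism of $\mathcal E^1_{\min}(\mathbb C)$: there is a linear homeomorphism $T$ of $\mathcal E^1_{\min}(\mathbb C)$ onto itself such that $\mathcal S(f|_{\alpha\mathbb N_0})=Tf$ as entire functions, for every $f\in\mathcal E^1_{\min}(\mathbb C)$. -/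

import Mathlib

open MeasureTheory Polynomial
open scoped ComplexConjugate Nat

/-- The set `αℕ₀ = {0, α, 2α, …}`, as a subset of the real line. -/
def scaledNat (α : ℝ) : Set ℝ := Set.range fun n : ℕ => α * n

/-- The scaled Poisson distribution
`π_{α,σ} = exp(-σ/α²) ∑ₙ (1/n!) (σ/α²)ⁿ δ_{αn}`, a measure on `αℕ₀`. -/
noncomputable def scaledPoisson (α σ : ℝ) : Measure (scaledNat α) :=
  Measure.sum fun n : ℕ =>
    ENNReal.ofReal (Real.exp (-(σ / α ^ 2)) * ((1 / (n ! : ℝ)) * (σ / α ^ 2) ^ n)) •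
      Measure.dirac (⟨α * n, n, rfl⟩ : scaledNat α)

/-- A sequence of complex polynomials that is monic (`cₙ` has degree `n` and leading
coefficient `1`) and orthogonal with respect to `π_{α,σ}`. -/
structure IsMonicOrthogonalSeq (α σ : ℝ) (c : ℕ → ℂ[X]) : Prop where
  monic : ∀ n, (c n).Monic
  natDegree_eq : ∀ n, (c n).natDegree = n
  orthogonal : ∀ m n, m ≠ n →
    ∫ x : scaledNat α, (c m).eval ((x : ℝ) : ℂ) * conj ((c n).eval ((x : ℝ) : ℂ))
      ∂(scaledPoisson α σ) = 0

/-- The `n`-th Taylor coefficient of `f` at `0`. -/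
noncomputable def taylorCoeff (f : ℂ → ℂ) (n : ℕ) : ℂ := iteratedDeriv n f 0 / (n ! : ℂ)

theorem taylorCoeff_add {f g : ℂ → ℂ} (hf : Differentiable ℂ f) (hg : Differentiable ℂ g)
    (n : ℕ) : taylorCoeff (f + g) n = taylorCoeff f n + taylorCoeff g n := by
  unfold taylorCoeff
  rw [iteratedDeriv_add hf.contDiff.contDiffAt hg.contDiff.contDiffAt, add_div]

theorem taylorCoeff_smul {f : ℂ → ℂ} (hf : Differentiable ℂ f) (a : ℂ)
    (n : ℕ) : taylorCoeff (a • f) n = a * taylorCoeff f n := by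
  unfold taylorCoeff
  rw [iteratedDeriv_const_smul hf.contDiff.contDiffAt, smul_eq_mul, mul_div_assoc]

/-- The Bargmann space `𝔽_σ(ℂ)`: all entire functions `f(z) = ∑ fₙ zⁿ` with
`∑ |fₙ|² n! σⁿ < ∞`. -/
noncomputable def bargmannSpace (σ : ℝ) : Submodule ℂ (ℂ → ℂ) where
  carrier := {f | Differentiable ℂ f ∧
    Summable fun n : ℕ => ‖taylorCoeff f n‖ ^ 2 * ((n ! : ℝ) * σ ^ n)}
  zero_mem' := by
    refine ⟨differentiable_const 0, ?_⟩
    have h : ∀ n, taylorCoeff (0 : ℂ → ℂ) n = 0 := fun n => by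
      have := taylorCoeff_smul (differentiable_const (0 : ℂ) : Differentiable ℂ fun _ : ℂ => (0 : ℂ)) 0 n
      simpa using this
    simp [h, summable_zero]
  add_mem' := by
    rintro f g ⟨hf, hf2⟩ ⟨hg, hg2⟩
    refine ⟨hf.add hg, ?_⟩
    refine Summable.of_norm_bounded ((hf2.norm.mul_left 2).add (hg2.norm.mul_left 2)) fun n => ?_
    rw [taylorCoeff_add hf hg]
    simp only [norm_mul _ ((n ! : ℝ) * σ ^ n), Real.norm_of_nonneg (sq_nonneg _)]
    have h1 := norm_add_le (taylorCoeff f n) (taylorCoeff g n)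
    have h2 : ‖taylorCoeff f n + taylorCoeff g n‖ ^ 2 ≤
        2 * ‖taylorCoeff f n‖ ^ 2 + 2 * ‖taylorCoeff g n‖ ^ 2 := by
      nlinarith [norm_nonneg (taylorCoeff f n + taylorCoeff g n),
        sq_nonneg (‖taylorCoeff f n‖ - ‖taylorCoeff g n‖)]
    nlinarith [mul_le_mul_of_nonneg_right h2 (norm_nonneg ((n ! : ℝ) * σ ^ n))]
  smul_mem' := by
    rintro a f ⟨hf, hf2⟩
    refine ⟨hf.const_smul a, ?_⟩
    refine (hf2.mul_left (‖a‖ ^ 2)).congr fun n => ?_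
    rw [taylorCoeff_smul hf, norm_mul]
    ring

/-- The inner product `(f, g) = ∑ₙ fₙ conj(gₙ) n! σⁿ` of the Bargmann space. -/
noncomputable def bargmannInner (σ : ℝ) (f g : bargmannSpace σ) : ℂ :=
  ∑' n : ℕ, taylorCoeff f n * conj (taylorCoeff g n) * ((n ! : ℂ) * (σ : ℂ) ^ n)

/-- `S` is a generalized Segal--Bargmann transform for `π_{α,σ}`: a unitary operator
(a linear bijection that preserves inner products) from `L²(αℕ₀, π_{α,σ})` onto `𝔽_σ(ℂ)`
with `(S cₙ)(z) = zⁿ`, where `(cₙ)` is the monic sequence of polynomials orthogonal with respect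
to `π_{α,σ}`. -/
structure IsSegalBargmann (α σ : ℝ)
    (S : Lp ℂ 2 (scaledPoisson α σ) ≃ₗ[ℂ] bargmannSpace σ) : Prop where
  inner_map : ∀ f g, bargmannInner σ (S f) (S g) =
    ∫ x, f x * conj (g x) ∂(scaledPoisson α σ)
  map_orthogonal : ∃ c : ℕ → ℂ[X], IsMonicOrthogonalSeq α σ c ∧
    ∀ n, ∃ p : Lp ℂ 2 (scaledPoisson α σ),
      (p =ᵐ[scaledPoisson α σ] fun x => (c n).eval ((x : ℝ) : ℂ)) ∧
      ∀ z : ℂ, (S p : ℂ → ℂ) z = z ^ n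

/-- The entire functions `f` with `sup_z |f(z)| exp(-|z|/n) < ∞` for all `n ≥ 1`
(order at most 1 and minimal type), as a linear subspace of all functions. -/
def eMinSubmodule : Submodule ℂ (ℂ → ℂ) where
  carrier := {f | Differentiable ℂ f ∧
    ∀ n : ℕ+, BddAbove (Set.range fun z : ℂ => ‖f z‖ * Real.exp (-‖z‖ / (n : ℝ)))}
  zero_mem' := ⟨differentiable_const 0, fun n => ⟨0, by rintro _ ⟨z, rfl⟩; simp⟩⟩
  add_mem' := by
    rintro f g ⟨hf, hf2⟩ ⟨hg, hg2⟩
    refine ⟨hf.add hg, fun n => ?_⟩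
    obtain ⟨A, hA⟩ := hf2 n
    obtain ⟨B, hB⟩ := hg2 n
    refine ⟨A + B, ?_⟩
    rintro _ ⟨z, rfl⟩
    have h1 := hA ⟨z, rfl⟩
    have h2 := hB ⟨z, rfl⟩
    have h3 := mul_le_mul_of_nonneg_right (norm_add_le (f z) (g z))
      (Real.exp_pos (-‖z‖ / (n : ℝ))).le
    simp only [Pi.add_apply] at *
    linarith
  smul_mem' := by
    rintro a f ⟨hf, hf2⟩
    refine ⟨hf.const_smul a, fun n => ?_⟩
    obtain ⟨A, hA⟩ := hf2 n
    refine ⟨‖a‖ * A, ?_⟩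
    rintro _ ⟨z, rfl⟩
    have h1 := mul_le_mul_of_nonneg_left (hA ⟨z, rfl⟩) (norm_nonneg a)
    simp only [Pi.smul_apply, norm_smul] at *
    linarith

/-- The space `ℰ¹_min(ℂ)` of entire functions of order at most 1 and minimal type. It is a type of
its own, so that it does not carry the topology of pointwise convergence. -/
def EMin : Type := eMinSubmodule

namespace EMin

instance : AddCommGroup EMin := inferInstanceAs (AddCommGroup eMinSubmodule)

instance : Module ℂ EMin := inferInstanceAs (Module ℂ eMinSubmodule)

instance : CoeFun EMin fun _ => ℂ → ℂ := ⟨fun f => Subtype.val f⟩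

theorem bddAbove (f : EMin) (n : ℕ+) :
    BddAbove (Set.range fun z : ℂ => ‖f z‖ * Real.exp (-‖z‖ / (n : ℝ))) :=
  f.2.2 n

theorem add_apply (f g : EMin) (z : ℂ) : (f + g) z = f z + g z := rfl

theorem smul_apply (a : ℂ) (f : EMin) (z : ℂ) : (a • f) z = a * f z := rfl

/-- The norm `‖f‖ₙ = sup_z |f(z)| exp(-|z|/n)`. -/
noncomputable def expNorm : SeminormFamily ℂ EMin ℕ+ := fun n =>
  Seminorm.of (fun f => ⨆ z : ℂ, ‖f z‖ * Real.exp (-‖z‖ / (n : ℝ)))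
    (fun f g => by
      refine ciSup_le fun z => ?_
      have h1 := le_ciSup (bddAbove f n) z
      have h2 := le_ciSup (bddAbove g n) z
      have h3 := mul_le_mul_of_nonneg_right (norm_add_le (f z) (g z))
        (Real.exp_pos (-‖z‖ / (n : ℝ))).le
      simp only [add_apply] at *
      linarith)
    (fun a f => by
      rw [Real.mul_iSup_of_nonneg (norm_nonneg a)]
      simp only [smul_apply, norm_mul, mul_assoc])

/-- The Fréchet topology of `ℰ¹_min(ℂ)`, generated by the norms `‖·‖ₙ`, `n ≥ 1`. -/
noncomputable instance : TopologicalSpace EMin := expNorm.moduleFilterBasis.topology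

theorem withSeminorms : WithSeminorms expNorm := ⟨rfl⟩

end EMin

/-! The orthogonal polynomials are the Charlier polynomials, given by `c_{n+1}(x) = x c_n(x - α) -
(σ/α) c_n(x)`. Under the Poisson law this raising operator is, up to `σ/α`, the adjoint of the
forward difference with step `α`, which lowers `c_{n+1}` to `α (n+1) c_n`. Orthogonality and the
squared norms `n! σ^n` follow (`poissonIntegral_charlier_mul_charlier`). These are the norms of
`z^n` in the Bargmann space, so completeness (`eq_zero_of_inner_charlierLp_eq_zero`) gives the
unitary operator; pairing with `c_n` recovers the `n`-th Taylor coefficient, which gives uniqueness.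

On polynomials, `c_n ↦ z^n` turns multiplication by `x` into `(z + σ/α)(1 + α d/dz)`; iterating this
operator on `1` gives the images of the monomials. For `f` in `EMin`, Cauchy's estimate makes `k!
f_k` decay faster than every geometric sequence (`EMin.taylorCoeff_bound`). Hence `f ↦ ∑ f_k p_k` is
continuous on `EMin` whenever suitable weighted norms of `p_k` are at most `C M^k k!`. Both the map
and its inverse have such monomial images (`isTame_touchard`, `isTame_charlier`), and density of
polynomials makes the extensions mutually inverse. Density also identifies the extension with the
unitary operator, coefficient by coefficient (`IsSegalBargmann.restrict_eq`). -/

/-! ### Entire functions and their Taylor coefficients -/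

theorem differentiable_and_taylorCoeff_of_hasSum {a : ℕ → ℂ} {f : ℂ → ℂ}
    (hf : ∀ z, HasSum (fun n => a n * z ^ n) (f z)) :
    Differentiable ℂ f ∧ ∀ n, taylorCoeff f n = a n := by
  set p := FormalMultilinearSeries.ofScalars ℂ a with hp
  have hr : p.radius = ⊤ := by
    refine p.radius_eq_top_of_summable_norm fun r => ?_
    refine ((hf (r : ℂ)).summable.norm).congr fun n => ?_
    simp [hp]
  have hsum : p.sum = f := by
    funext z
    rw [← (hf z).tsum_eq, FormalMultilinearSeries.sum]
    simp [hp, mul_comm]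
  have hball := p.hasFPowerSeriesOnBall (by rw [hr]; exact ENNReal.zero_lt_top)
  rw [hsum, hr] at hball
  have hdiff : Differentiable ℂ f := by
    have := hball.differentiableOn
    rw [← differentiableOn_univ]
    refine this.mono fun z _ => by simp
  refine ⟨hdiff, fun n => ?_⟩
  have h1 := (hdiff.analyticAt 0).hasFPowerSeriesAt
  have h3 := congrArg (fun q : FormalMultilinearSeries ℂ ℂ ℂ => q.coeff n)
    (h1.eq_formalMultilinearSeries hball.hasFPowerSeriesAt)
  simp only [hp, FormalMultilinearSeries.coeff_ofScalars] at h3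
  exact h3

theorem hasSum_taylorCoeff {f : ℂ → ℂ} (hf : Differentiable ℂ f) (z : ℂ) :
    HasSum (fun n => taylorCoeff f n * z ^ n) (f z) := by
  have h := Complex.hasSum_taylorSeries_of_entire hf 0 z
  refine (congrArg (HasSum · (f z)) (funext fun n => ?_)).mp h
  rw [taylorCoeff, sub_zero, smul_eq_mul, smul_eq_mul]
  ring

theorem eq_of_taylorCoeff_eq {f g : ℂ → ℂ} (hf : Differentiable ℂ f) (hg : Differentiable ℂ g)
    (h : ∀ n, taylorCoeff f n = taylorCoeff g n) : f = g := by
  funext z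
  refine (hasSum_taylorCoeff hf z).unique ?_
  simpa only [h] using hasSum_taylorCoeff hg z

theorem taylorCoeff_polynomial (p : ℂ[X]) (n : ℕ) :
    taylorCoeff (fun z => p.eval z) n = p.coeff n := by
  refine (differentiable_and_taylorCoeff_of_hasSum fun z => ?_).2 n
  rw [eval_eq_sum_range]
  refine hasSum_sum_of_ne_finset_zero fun k hk => ?_
  rw [coeff_eq_zero_of_natDegree_lt (by simpa using hk), zero_mul]

/-! ### Growth norms and Cauchy estimates -/

namespace EMin

theorem differentiable (f : EMin) : Differentiable ℂ f.1 := f.2.1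

theorem norm_apply_le (f : EMin) (n : ℕ+) (z : ℂ) :
    ‖f z‖ ≤ expNorm n f * Real.exp (‖z‖ / n) := by
  have h1 : ‖f z‖ * Real.exp (-‖z‖ / n) ≤ expNorm n f := le_ciSup (bddAbove f n) z
  calc ‖f z‖ = ‖f z‖ * Real.exp (-‖z‖ / n) * Real.exp (‖z‖ / n) := by
        rw [mul_assoc, ← Real.exp_add, neg_div, neg_add_cancel, Real.exp_zero, mul_one]
    _ ≤ _ := by gcongr

theorem mul_exp_le {x C t : ℝ} (h : x ≤ C * Real.exp t) : x * Real.exp (-t) ≤ C := by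
  calc x * Real.exp (-t) ≤ C * Real.exp t * Real.exp (-t) := by gcongr
    _ = C := by rw [mul_assoc, ← Real.exp_add, add_neg_cancel, Real.exp_zero, mul_one]

theorem expNorm_le {f : EMin} {n : ℕ+} {C : ℝ} (h : ∀ z, ‖f z‖ ≤ C * Real.exp (‖z‖ / n)) :
    expNorm n f ≤ C :=
  ciSup_le fun z => by rw [neg_div]; exact mul_exp_le (h z)

/-- An entire function with the growth bounds of `EMin`, as an element of `EMin`. -/
def ofGrowth (f : ℂ → ℂ) (hf : Differentiable ℂ f)
    (h : ∀ n : ℕ+, ∃ C, ∀ z, ‖f z‖ ≤ C * Real.exp (‖z‖ / n)) : EMin :=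
  ⟨f, hf, fun n => by
    obtain ⟨C, hC⟩ := h n
    refine ⟨C, ?_⟩
    rintro _ ⟨z, rfl⟩
    simp only [neg_div]
    exact mul_exp_le (hC z)⟩

instance : IsTopologicalAddGroup EMin := withSeminorms.topologicalAddGroup

instance : ContinuousSMul ℂ EMin := withSeminorms.continuousSMul

theorem ext {f g : EMin} (h : ∀ z, f z = g z) : f = g := Subtype.ext (funext h)

instance : T2Space EMin := by
  have : T1Space EMin := withSeminorms.T1_of_separating fun f hf => by
    refine ⟨1, fun h => hf (ext fun z => ?_)⟩
    have h1 := norm_apply_le f 1 z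
    rw [h, zero_mul] at h1
    exact norm_le_zero_iff.1 h1
  infer_instance

/-- Cauchy's estimate on the circle of radius `m k`, where the growth factor is exactly `e^k`; then
`k! ≤ k^k` cancels the power of `k`. For `k = 0` this radius degenerates, so that case is separate.
-/
theorem taylorCoeff_bound (f : EMin) (m : ℕ+) (k : ℕ) :
    ‖taylorCoeff f.1 k‖ * k ! ≤ expNorm m f * (Real.exp 1 / m) ^ k := by
  have hm : (0 : ℝ) < m := by exact_mod_cast m.pos
  rcases Nat.eq_zero_or_pos k with rfl | hk
  · have := norm_apply_le f m 0
    simpa [taylorCoeff] using this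
  have hk' : (0 : ℝ) < k := by exact_mod_cast hk
  have hR : 0 < (m : ℝ) * k := by positivity
  have h1 := Complex.norm_iteratedDeriv_le_of_forall_mem_sphere_norm_le (c := 0)
    (C := expNorm m f * Real.exp k) k hR f.differentiable.diffContOnCl (fun z hz => by
      have h2 := norm_apply_le f m z
      rw [mem_sphere_zero_iff_norm] at hz
      rw [hz, mul_div_cancel_left₀ _ hm.ne'] at h2
      exact h2)
  have hfac : (0 : ℝ) < k ! := by positivity
  have h3 : ‖taylorCoeff f.1 k‖ ≤ expNorm m f * Real.exp k / (m * k) ^ k := by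
    rw [taylorCoeff, norm_div, Complex.norm_natCast, div_le_iff₀ hfac]
    refine h1.trans (le_of_eq ?_)
    ring
  have h4 : (k ! : ℝ) ≤ (k : ℝ) ^ k := by exact_mod_cast Nat.factorial_le_pow k
  have h5 : 0 ≤ expNorm m f := apply_nonneg _ _
  calc ‖taylorCoeff f.1 k‖ * k ! ≤ expNorm m f * Real.exp k / (m * k) ^ k * k ^ k := by gcongr
    _ = _ := by
      rw [div_pow, ← Real.exp_nat_mul, mul_one, mul_pow]
      field_simp

end EMin

/-! ### Factorially weighted coefficient norms of polynomials -/

/-- The weighted `ℓ¹` norm `∑ₖ |pₖ| k! Rᵏ` of the coefficients of a polynomial. -/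
noncomputable def borelNorm (R : ℝ) (p : ℂ[X]) : ℝ := ∑' k, ‖p.coeff k‖ * (k ! * R ^ k)

section borelNorm

variable {R : ℝ} (p q : ℂ[X])

theorem summable_coeff_mul (p : ℂ[X]) (b : ℕ → ℝ) : Summable fun k => ‖p.coeff k‖ * b k := by
  refine summable_of_ne_finset_zero (s := Finset.range (p.natDegree + 1)) fun k hk => ?_
  rw [coeff_eq_zero_of_natDegree_lt (by simpa using hk), norm_zero, zero_mul]

theorem borelNorm_nonneg (hR : 0 ≤ R) : 0 ≤ borelNorm R p :=
  tsum_nonneg fun k => by positivity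

theorem borelNorm_add_le (hR : 0 ≤ R) : borelNorm R (p + q) ≤ borelNorm R p + borelNorm R q := by
  unfold borelNorm
  rw [← (summable_coeff_mul _ _).tsum_add (summable_coeff_mul _ _)]
  refine (summable_coeff_mul _ _).tsum_le_tsum (fun k => ?_)
    ((summable_coeff_mul _ _).add (summable_coeff_mul _ _))
  rw [coeff_add, ← add_mul]
  gcongr
  exact norm_add_le _ _

theorem borelNorm_C_mul (a : ℂ) : borelNorm R (C a * p) = ‖a‖ * borelNorm R p := by
  unfold borelNorm
  rw [← tsum_mul_left]
  simp only [coeff_C_mul, norm_mul, mul_assoc]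

theorem borelNorm_X_pow (n : ℕ) : borelNorm R (X ^ n) = n ! * R ^ n := by
  unfold borelNorm
  rw [tsum_eq_single n fun k hk => by simp [coeff_X_pow, hk]]
  simp

/-- The shift replaces the weight `k! R^k` by `(k+1)! R^(k+1)`, and `k ≤ N` on the support. This
factor is the source of the `n!` in the later tameness bounds. -/
theorem borelNorm_X_mul_le (hR : 0 ≤ R) {N : ℕ} (hN : p.natDegree ≤ N) :
    borelNorm R (X * p) ≤ (N + 1) * R * borelNorm R p := by
  unfold borelNorm
  rw [(summable_coeff_mul _ _).tsum_eq_zero_add, ← tsum_mul_left]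
  simp only [coeff_X_mul_zero, norm_zero, zero_mul, zero_add, coeff_X_mul]
  refine Summable.tsum_le_tsum (fun k => ?_) (summable_coeff_mul _ _)
    ((summable_coeff_mul _ _).mul_left _)
  rcases le_or_gt k N with hk | hk
  · have hk' : (k : ℝ) ≤ N := by exact_mod_cast hk
    rw [Nat.factorial_succ, pow_succ]
    push_cast
    have h : 0 ≤ ‖p.coeff k‖ * k ! * R ^ k * R := by positivity
    nlinarith [mul_le_mul_of_nonneg_right hk' h]
  · rw [coeff_eq_zero_of_natDegree_lt (hN.trans_lt hk)]
    simp

/-- The weight `k!` absorbs the factor produced by differentiation, so the cost does not depend on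
the degree. -/
theorem borelNorm_derivative_le (hR : 0 < R) :
    borelNorm R (derivative p) ≤ R⁻¹ * borelNorm R p := by
  unfold borelNorm
  rw [(summable_coeff_mul p _).tsum_eq_zero_add, mul_add, ← tsum_mul_left]
  refine le_add_of_nonneg_of_le (by positivity) (le_of_eq (tsum_congr fun k => ?_))
  rw [coeff_derivative, norm_mul, Nat.factorial_succ, pow_succ]
  have : ‖(k : ℂ) + 1‖ = k + 1 := by
    rw [← Nat.cast_add_one, Complex.norm_natCast, Nat.cast_add_one]
  rw [this]
  push_cast
  field_simp

/-- Each monomial satisfies `|z|^k ≤ k! R^k exp(|z|/R)`, by one term of the exponential series. With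
`R = n` this controls `expNorm n`. -/
theorem norm_eval_le_borelNorm (hR : 0 < R) (z : ℂ) :
    ‖p.eval z‖ ≤ borelNorm R p * Real.exp (‖z‖ / R) := by
  have h1 : ∀ k, ‖p.coeff k‖ * ‖z‖ ^ k ≤
      ‖p.coeff k‖ * (k ! * R ^ k) * Real.exp (‖z‖ / R) := fun k => by
    have h2 := Real.pow_div_factorial_le_exp (‖z‖ / R) (by positivity) k
    rw [mul_assoc]
    gcongr
    calc ‖z‖ ^ k = k ! * R ^ k * ((‖z‖ / R) ^ k / k !) := by
          rw [div_pow]; field_simp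
      _ ≤ _ := by gcongr
  calc ‖p.eval z‖ ≤ ∑ k ∈ Finset.range (p.natDegree + 1), ‖p.coeff k‖ * ‖z‖ ^ k := by
        rw [eval_eq_sum_range]
        refine (norm_sum_le _ _).trans (le_of_eq ?_)
        simp only [norm_mul, norm_pow]
    _ ≤ ∑ k ∈ Finset.range (p.natDegree + 1),
          ‖p.coeff k‖ * (k ! * R ^ k) * Real.exp (‖z‖ / R) :=
        Finset.sum_le_sum fun k _ => h1 k
    _ ≤ _ := by
        rw [← Finset.sum_mul]
        gcongr
        exact (summable_coeff_mul _ _).sum_le_tsum _ fun k _ => by positivity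

end borelNorm

/-! ### Continuous extension of maps from monomials to `EMin` -/

namespace EMin

/-- Polynomials, as elements of `EMin`. -/
noncomputable def ofPolynomial : ℂ[X] →ₗ[ℂ] EMin where
  toFun p := ofGrowth (fun z => p.eval z) p.differentiable fun n =>
    ⟨borelNorm n p, fun z => norm_eval_le_borelNorm p (by exact_mod_cast n.pos) z⟩
  map_add' p q := ext fun z => eval_add
  map_smul' a p := ext fun z => eval_smul ..

theorem ofPolynomial_apply (p : ℂ[X]) (z : ℂ) : ofPolynomial p z = p.eval z := rfl

theorem taylorCoeff_ofPolynomial (p : ℂ[X]) (n : ℕ) :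
    taylorCoeff (ofPolynomial p).1 n = p.coeff n := taylorCoeff_polynomial p n

/-- Evaluation at a point as a linear functional. -/
def evalₗ (z : ℂ) : EMin →ₗ[ℂ] ℂ where
  toFun f := f z
  map_add' _ _ := rfl
  map_smul' _ _ := rfl

/-- The `n`-th Taylor coefficient as a linear functional. -/
noncomputable def coeffₗ (n : ℕ) : EMin →ₗ[ℂ] ℂ where
  toFun f := taylorCoeff f.1 n
  map_add' f g := taylorCoeff_add f.differentiable g.differentiable n
  map_smul' a f := taylorCoeff_smul f.differentiable a n

/-- The `n`-th Taylor coefficient as a continuous linear functional. -/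
noncomputable def coeffL (n : ℕ) : EMin →L[ℂ] ℂ :=
  ⟨coeffₗ n, withSeminorms.continuous_of_isBounded (norm_withSeminorms ℂ ℂ) _ fun _ => by
    have hn : (0 : ℝ) < n ! := by positivity
    refine ⟨{1}, (Real.exp 1 ^ n / n !).toNNReal, fun f => ?_⟩
    have h := taylorCoeff_bound f 1 n
    rw [← le_div_iff₀ hn] at h
    simp only [Seminorm.comp_apply, coe_normSeminorm, Finset.sup_singleton, _root_.smul_apply]
    refine h.trans (le_of_eq ?_)
    rw [NNReal.smul_def, Real.coe_toNNReal _ (by positivity)]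
    simp
    ring⟩

/-- A sequence `pₖ` of polynomials such that `f ↦ ∑ fₖ pₖ` is continuous on `EMin`. -/
def IsTame (p : ℕ → ℂ[X]) : Prop :=
  ∀ n : ℕ+, ∃ C M : ℝ, 0 ≤ C ∧ 0 ≤ M ∧ ∀ k, borelNorm n (p k) ≤ C * M ^ k * k !

theorem isTame_X_pow : IsTame fun k => X ^ k := fun n =>
  ⟨1, n, by positivity, by positivity, fun k => by rw [borelNorm_X_pow]; linarith⟩

theorem IsTame.exists_bound {p : ℕ → ℂ[X]} (hp : IsTame p) (n : ℕ+) :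
    ∃ (m : ℕ+) (C : ℝ), 0 ≤ C ∧ ∀ (f : EMin) k,
      ‖taylorCoeff f.1 k‖ * borelNorm n (p k) ≤ C * expNorm m f * (1 / 2) ^ k := by
  obtain ⟨C, M, hC, hM, h⟩ := hp n
  -- The coefficients decay like `(e/m)^k / k!` for every `m`, so this `m` beats the growth `M^k k!`
  -- and leaves ratio at most `1/2`.
  obtain ⟨m, hm⟩ := exists_nat_ge (2 * Real.exp 1 * M)
  refine ⟨m.succPNat, C, hC, fun f k => ?_⟩
  have h0 : (0 : ℝ) < m.succPNat := by exact_mod_cast m.succPNat.pos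
  have h1 : Real.exp 1 / m.succPNat * M ≤ 1 / 2 := by
    rw [div_mul_eq_mul_div, div_le_iff₀ h0]
    simp only [Nat.succPNat_coe, Nat.succ_eq_add_one, Nat.cast_add, Nat.cast_one]
    linarith
  have h2 := taylorCoeff_bound f m.succPNat k
  have h3 : 0 ≤ expNorm m.succPNat f := apply_nonneg _ _
  calc ‖taylorCoeff f.1 k‖ * borelNorm n (p k)
      ≤ ‖taylorCoeff f.1 k‖ * (C * M ^ k * k !) := by gcongr; exact h k
    _ = C * (‖taylorCoeff f.1 k‖ * k !) * M ^ k := by ring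
    _ ≤ C * (expNorm m.succPNat f * (Real.exp 1 / m.succPNat) ^ k) * M ^ k := by gcongr
    _ = C * expNorm m.succPNat f * (Real.exp 1 / m.succPNat * M) ^ k := by
      rw [mul_pow]; ring
    _ ≤ _ := by gcongr

variable {p : ℕ → ℂ[X]} (hp : IsTame p)

include hp in
theorem IsTame.summable (n : ℕ+) (f : EMin) :
    Summable fun k => ‖taylorCoeff f.1 k‖ * borelNorm n (p k) := by
  obtain ⟨m, C, hC, h⟩ := hp.exists_bound n
  exact Summable.of_nonneg_of_le
    (fun k => mul_nonneg (norm_nonneg _) (borelNorm_nonneg _ (by positivity))) (h f)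
    (summable_geometric_two.mul_left _)

theorem norm_term_le (p : ℕ → ℂ[X]) (n : ℕ+) (f : EMin) (z : ℂ) (k : ℕ) :
    ‖taylorCoeff f.1 k * (p k).eval z‖ ≤
      ‖taylorCoeff f.1 k‖ * borelNorm n (p k) * Real.exp (‖z‖ / n) := by
  rw [norm_mul, mul_assoc]
  gcongr
  exact norm_eval_le_borelNorm _ (by exact_mod_cast n.pos) z

include hp in
theorem IsTame.summable_norm_apply (f : EMin) (z : ℂ) :
    Summable fun k => ‖taylorCoeff f.1 k * (p k).eval z‖ :=
  Summable.of_nonneg_of_le (fun _ => norm_nonneg _) (norm_term_le p 1 f z)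
    ((hp.summable 1 f).mul_right _)

include hp in
theorem IsTame.summable_apply (f : EMin) (z : ℂ) :
    Summable fun k => taylorCoeff f.1 k * (p k).eval z :=
  (hp.summable_norm_apply f z).of_norm

include hp in
theorem IsTame.norm_tsum_le (n : ℕ+) (f : EMin) (z : ℂ) :
    ‖∑' k, taylorCoeff f.1 k * (p k).eval z‖ ≤
      (∑' k, ‖taylorCoeff f.1 k‖ * borelNorm n (p k)) * Real.exp (‖z‖ / n) := by
  rw [← tsum_mul_right]
  exact tsum_of_norm_bounded ((hp.summable n f).mul_right _).hasSum (norm_term_le p n f z)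

include hp in
theorem IsTame.differentiable (f : EMin) :
    Differentiable ℂ fun z => ∑' k, taylorCoeff f.1 k * (p k).eval z := by
  intro z
  -- On a ball the exponential factor is bounded, so the series of entire functions converges
  -- uniformly there.
  refine (Complex.differentiableOn_tsum_of_summable_norm (U := Metric.ball 0 (‖z‖ + 1))
    ((hp.summable 1 f).mul_right (Real.exp (‖z‖ + 1)))
    (fun k => ((p k).differentiable.const_mul _).differentiableOn) Metric.isOpen_ball
    fun k w hw => ?_).differentiableAt (Metric.isOpen_ball.mem_nhds (by simp))
  rw [mem_ball_zero_iff] at hw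
  refine (norm_term_le p 1 f w k).trans ?_
  have := borelNorm_nonneg (R := ((1 : ℕ+) : ℝ)) (p k) (by positivity)
  gcongr
  simpa using hw.le

/-- The linear map `f ↦ ∑ fₖ pₖ` on `EMin`, for a tame sequence of polynomials `pₖ`. -/
noncomputable def extendₗ : EMin →ₗ[ℂ] EMin where
  toFun f := ofGrowth (fun z => ∑' k, taylorCoeff f.1 k * (p k).eval z) (hp.differentiable f)
    fun n => ⟨_, hp.norm_tsum_le n f⟩
  map_add' f g := ext fun z => by
    change ∑' k, taylorCoeff (f.1 + g.1) k * (p k).eval z =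
      ∑' k, taylorCoeff f.1 k * (p k).eval z + ∑' k, taylorCoeff g.1 k * (p k).eval z
    rw [← (hp.summable_apply f z).tsum_add (hp.summable_apply g z)]
    simp only [taylorCoeff_add f.differentiable g.differentiable, add_mul]
  map_smul' a f := ext fun z => by
    change ∑' k, taylorCoeff (a • f.1) k * (p k).eval z =
      a * ∑' k, taylorCoeff f.1 k * (p k).eval z
    rw [← tsum_mul_left]
    simp only [taylorCoeff_smul f.differentiable, mul_assoc]

theorem extendₗ_apply (f : EMin) (z : ℂ) :
    extendₗ hp f z = ∑' k, taylorCoeff f.1 k * (p k).eval z := rfl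

theorem continuous_extendₗ : Continuous (extendₗ hp) :=
  withSeminorms.continuous_of_isBounded withSeminorms _ fun n => by
    obtain ⟨m, C, hC, h⟩ := hp.exists_bound n
    refine ⟨{m}, (C * 2).toNNReal, fun f => ?_⟩
    simp only [Seminorm.comp_apply, Finset.sup_singleton, _root_.smul_apply]
    refine (expNorm_le (hp.norm_tsum_le n f)).trans ?_
    rw [NNReal.smul_def, Real.coe_toNNReal _ (by positivity)]
    refine ((hp.summable n f).tsum_le_tsum (h f) (summable_geometric_two.mul_left _)).trans
      (le_of_eq ?_)
    rw [tsum_mul_left, tsum_geometric_two, smul_eq_mul]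
    ring

/-- The continuous linear map `f ↦ ∑ fₖ pₖ` on `EMin`, for a tame sequence of polynomials `pₖ`. -/
noncomputable def extend : EMin →L[ℂ] EMin := ⟨extendₗ hp, continuous_extendₗ hp⟩

theorem extend_ofPolynomial_X_pow (n : ℕ) :
    extend hp (ofPolynomial (X ^ n)) = ofPolynomial (p n) := by
  refine ext fun z => (extendₗ_apply hp _ z).trans ?_
  rw [tsum_eq_single n fun k hk => by simp [taylorCoeff_ofPolynomial, coeff_X_pow, hk]]
  simp [taylorCoeff_ofPolynomial, ofPolynomial_apply]

theorem extend_ofPolynomial {L : ℂ[X] →ₗ[ℂ] ℂ[X]} (hL : ∀ n, L (X ^ n) = p n) (q : ℂ[X]) :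
    extend hp (ofPolynomial q) = ofPolynomial (L q) := by
  induction q using Polynomial.induction_on' with
  | add q r hq hr => simp only [map_add, hq, hr]
  | monomial n a =>
    rw [← C_mul_X_pow_eq_monomial, ← smul_eq_C_mul, map_smul, map_smul, map_smul, map_smul, hL,
      extend_ofPolynomial_X_pow]

/-- In each norm, the error of a partial sum is bounded by the tail of a summable series of weighted
norms. This gives density of polynomials in `EMin`. -/
theorem hasSum_taylor (f : EMin) :
    HasSum (fun k => taylorCoeff f.1 k • ofPolynomial (X ^ k)) f := by
  refine (withSeminorms.tendsto_nhds _ _).2 fun n ε hε => ?_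
  have hs := isTame_X_pow.summable n f
  have ht := tendsto_tsum_compl_atTop_zero fun k => ‖taylorCoeff f.1 k‖ * borelNorm n (X ^ k)
  filter_upwards [ht.eventually_lt_const hε] with s hs'
  refine lt_of_le_of_lt ?_ hs'
  rw [map_sub_rev]
  refine expNorm_le fun z => ?_
  have h1 := isTame_X_pow.summable_apply f z
  have h2 : (f - ∑ k ∈ s, taylorCoeff f.1 k • ofPolynomial (X ^ k)) z =
      ∑' k : {k // k ∉ s}, taylorCoeff f.1 k * (X ^ (k : ℕ) : ℂ[X]).eval z := by
    change evalₗ z (f - ∑ k ∈ s, taylorCoeff f.1 k • ofPolynomial (X ^ k)) = _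
    have h3 := h1.sum_add_tsum_subtype_compl s
    have h4 : evalₗ z f = ∑' k, taylorCoeff f.1 k * (X ^ k : ℂ[X]).eval z := by
      simp only [eval_pow, eval_X]
      exact (hasSum_taylorCoeff f.differentiable z).tsum_eq.symm
    rw [map_sub, map_sum, h4, ← h3]
    exact add_sub_cancel_left _ _
  rw [h2, ← tsum_mul_right]
  exact tsum_of_norm_bounded ((hs.subtype _).mul_right _).hasSum fun k => norm_term_le _ n f z k

theorem continuousLinearMap_ext {F : Type*} [AddCommGroup F] [Module ℂ F] [TopologicalSpace F]
    [T2Space F] {A B : EMin →L[ℂ] F} (h : ∀ n, A (ofPolynomial (X ^ n)) = B (ofPolynomial (X ^ n))) :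
    A = B := by
  ext f
  have hA := (hasSum_taylor f).mapL A
  have hB := (hasSum_taylor f).mapL B
  simp only [map_smul, h] at hA hB
  exact hA.unique hB

end EMin

/-! ### Charlier polynomials: raising, lowering and three-term recurrence -/

/-- The monic Charlier polynomials, scaled to be orthogonal with respect to `scaledPoisson α σ`. -/
noncomputable def charlier (α σ : ℝ) : ℕ → ℂ[X]
  | 0 => 1
  | n + 1 => X * (charlier α σ n).comp (X - C (α : ℂ)) - C (σ / α : ℂ) * charlier α σ n

theorem charlier_zero (α σ : ℝ) : charlier α σ 0 = 1 := rfl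

theorem charlier_eval_succ (α σ : ℝ) (n : ℕ) (x : ℂ) :
    (charlier α σ (n + 1)).eval x =
      x * (charlier α σ n).eval (x - α) - σ / α * (charlier α σ n).eval x := by
  simp [charlier]

theorem charlier_monic_and_natDegree (α σ : ℝ) (n : ℕ) :
    (charlier α σ n).Monic ∧ (charlier α σ n).natDegree = n := by
  induction n with
  | zero => simp [charlier_zero]
  | succ n ih =>
    have h1 : (X * (charlier α σ n).comp (X - C (α : ℂ))).Monic :=
      monic_X.mul (ih.1.comp (monic_X_sub_C _) (by simp))
    have h2 : (X * (charlier α σ n).comp (X - C (α : ℂ))).natDegree = n + 1 := by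
      rw [natDegree_X_mul, natDegree_comp, ih.2, natDegree_X_sub_C, mul_one]
      intro h
      rw [h, mul_zero] at h1
      exact h1.ne_zero rfl
    have h3 : (C (σ / α : ℂ) * charlier α σ n).degree <
        (X * (charlier α σ n).comp (X - C (α : ℂ))).degree := by
      rw [degree_eq_natDegree h1.ne_zero, h2]
      refine (degree_le_of_natDegree_le ((natDegree_C_mul_le _ _).trans ih.2.le)).trans_lt ?_
      exact_mod_cast n.lt_succ_self
    exact ⟨h1.sub_of_left h3,
      (natDegree_eq_of_degree_eq (degree_sub_eq_left_of_degree_lt h3)).trans h2⟩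

section

variable {α σ : ℝ} (hα : 0 < α)

/-- The lowering relation. Expanding both sides by the raising relation reduces it to the induction
hypothesis at `x` and at `x - α`. -/
theorem charlier_eval_add (n : ℕ) (x : ℂ) :
    (charlier α σ (n + 1)).eval (x + α) =
      (charlier α σ (n + 1)).eval x + α * (n + 1) * (charlier α σ n).eval x := by
  induction n generalizing x with
  | zero => simp [charlier]; ring
  | succ n ih =>
    have h1 := ih (x - α)
    rw [sub_add_cancel] at h1
    have h2 := charlier_eval_succ α σ n x
    rw [charlier_eval_succ α σ (n + 1) (x + α), charlier_eval_succ α σ (n + 1) x, ih x,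
      add_sub_cancel_right]
    push_cast
    linear_combination x * h1 - α * (n + 1) * h2

-- The lowering relation at `x - α` removes the shift from `c_{n+1}(x - α)`; the raising relation
-- then removes the remaining `x c_n(x - α)`.
include hα in
theorem charlier_succ_succ (n : ℕ) :
    charlier α σ (n + 2) = X * charlier α σ (n + 1) -
      C (σ / α + α * (n + 1) : ℂ) * charlier α σ (n + 1) - C (σ * (n + 1) : ℂ) * charlier α σ n := by
  have hα' : (α : ℂ) ≠ 0 := by exact_mod_cast hα.ne'
  refine Polynomial.funext fun x => ?_
  have h1 := charlier_eval_add (α := α) (σ := σ) n (x - α)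
  rw [sub_add_cancel] at h1
  have h2 := charlier_eval_succ α σ n x
  simp only [eval_sub, eval_mul, eval_X, eval_C]
  rw [charlier_eval_succ α σ (n + 1) x]
  have h3 : (σ : ℂ) / α * α = σ := div_mul_cancel₀ _ hα'
  linear_combination (-x) * h1 + α * (n + 1) * h2 - (n + 1) * (charlier α σ n).eval x * h3

theorem conj_charlier_eval (n : ℕ) (x : ℝ) :
    conj ((charlier α σ n).eval (x : ℂ)) = (charlier α σ n).eval (x : ℂ) := by
  induction n generalizing x with
  | zero => simp [charlier_zero]
  | succ n ih =>
    have h := ih (x - α)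
    push_cast at h
    simp [charlier_eval_succ, ih, h]

end

/-! ### The map from Charlier polynomials to monomials, and its inverse -/

/-- The operator `f ↦ (X + σ / α) (f + α f')`, to which multiplication by `X` corresponds under
`charlier α σ n ↦ X ^ n`. -/
noncomputable def touchardOp (α σ : ℝ) : ℂ[X] →ₗ[ℂ] ℂ[X] :=
  LinearMap.mulLeft ℂ (X + C (σ / α : ℂ)) ∘ₗ (LinearMap.id + (α : ℂ) • derivative)

theorem touchardOp_apply (α σ : ℝ) (f : ℂ[X]) :
    touchardOp α σ f = (X + C (σ / α : ℂ)) * (f + C (α : ℂ) * derivative f) := by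
  simp [touchardOp, smul_eq_C_mul]

/-- The images of the monomials under `charlier α σ n ↦ X ^ n`. -/
noncomputable def touchard (α σ : ℝ) (n : ℕ) : ℂ[X] := (touchardOp α σ)^[n] 1

theorem touchard_zero (α σ : ℝ) : touchard α σ 0 = 1 := rfl

theorem touchard_succ (α σ : ℝ) (n : ℕ) :
    touchard α σ (n + 1) = touchardOp α σ (touchard α σ n) :=
  Function.iterate_succ_apply' ..

/-- The linear map with `X ^ n ↦ p n`. -/
noncomputable def polyMap (p : ℕ → ℂ[X]) : ℂ[X] →ₗ[ℂ] ℂ[X] :=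
  (basisMonomials ℂ).constr ℂ p

theorem polyMap_X_pow (p : ℕ → ℂ[X]) (n : ℕ) : polyMap p (X ^ n) = p n := by
  have h := (basisMonomials ℂ).constr_basis ℂ p n
  rw [coe_basisMonomials] at h
  rw [X_pow_eq_monomial]
  exact h

theorem linearMap_ext_X_pow {M : Type*} [AddCommMonoid M] [Module ℂ M] {A B : ℂ[X] →ₗ[ℂ] M}
    (h : ∀ n, A (X ^ n) = B (X ^ n)) : A = B := by
  refine (basisMonomials ℂ).ext fun n => ?_
  have := h n
  rw [X_pow_eq_monomial] at this
  rwa [coe_basisMonomials]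

section

variable {α σ : ℝ} (hα : 0 < α)

-- These are the coefficients of the Charlier three-term recurrence solved for `X * charlier α σ n`,
-- which is why the operator corresponds to multiplication by `X`. At `n = 0` the last term
-- vanishes, so the truncated exponent is harmless.
include hα in
theorem touchardOp_X_pow (n : ℕ) :
    touchardOp α σ (X ^ n) = X ^ (n + 1) + C (σ / α + α * n : ℂ) * X ^ n +
      C (σ * n : ℂ) * X ^ (n - 1) := by
  have hα' : (α : ℂ) ≠ 0 := by exact_mod_cast hα.ne'
  have h : (C (σ / α : ℂ) * C (α : ℂ) : ℂ[X]) = C (σ : ℂ) := by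
    rw [← C_mul, div_mul_cancel₀ _ hα']
  rw [touchardOp_apply, derivative_X_pow]
  rcases n with _ | n
  · simp
  · simp only [Nat.add_sub_cancel, C_add, C_mul]
    linear_combination C ((n + 1 : ℕ) : ℂ) * X ^ n * h

theorem polyMap_touchard_X_mul (f : ℂ[X]) :
    polyMap (touchard α σ) (X * f) = touchardOp α σ (polyMap (touchard α σ) f) := by
  refine LinearMap.congr_fun (f := polyMap (touchard α σ) ∘ₗ LinearMap.mulLeft ℂ X)
    (g := touchardOp α σ ∘ₗ polyMap (touchard α σ)) (linearMap_ext_X_pow fun n => ?_) f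
  simp only [LinearMap.comp_apply, LinearMap.mulLeft_apply]
  rw [← pow_succ', polyMap_X_pow, polyMap_X_pow, touchard_succ]

include hα in
theorem polyMap_touchard_charlier (n : ℕ) :
    polyMap (touchard α σ) (charlier α σ n) = X ^ n := by
  induction n using Nat.twoStepInduction with
  | zero => simpa [charlier_zero, touchard_zero] using polyMap_X_pow (touchard α σ) 0
  | one =>
    have h1 : polyMap (touchard α σ) 1 = 1 := by
      simpa [touchard_zero] using polyMap_X_pow (touchard α σ) 0
    have h2 : charlier α σ 1 = X * 1 - (σ / α : ℂ) • 1 := by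
      rw [charlier, charlier_zero, one_comp, smul_eq_C_mul]
    rw [h2, map_sub, map_smul, polyMap_touchard_X_mul, h1, touchardOp_apply, smul_eq_C_mul]
    simp
  | more n h0 h1 =>
    rw [charlier_succ_succ hα, ← smul_eq_C_mul, ← smul_eq_C_mul, map_sub, map_sub, map_smul,
      map_smul, polyMap_touchard_X_mul, h0, h1, touchardOp_X_pow hα, smul_eq_C_mul, smul_eq_C_mul]
    push_cast
    ring

-- The reverse intertwining relation; on monomials it is exactly the Charlier recurrence.
include hα in
theorem polyMap_charlier_touchardOp (f : ℂ[X]) :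
    polyMap (charlier α σ) (touchardOp α σ f) = X * polyMap (charlier α σ) f := by
  refine LinearMap.congr_fun (f := polyMap (charlier α σ) ∘ₗ touchardOp α σ)
    (g := LinearMap.mulLeft ℂ X ∘ₗ polyMap (charlier α σ)) (linearMap_ext_X_pow fun n => ?_) f
  simp only [LinearMap.comp_apply, LinearMap.mulLeft_apply]
  rw [touchardOp_X_pow hα, ← smul_eq_C_mul, ← smul_eq_C_mul, map_add, map_add, map_smul, map_smul,
    polyMap_X_pow, polyMap_X_pow, polyMap_X_pow, smul_eq_C_mul, smul_eq_C_mul]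
  rcases n with _ | n
  · simp [charlier]
  · rw [charlier_succ_succ hα]
    push_cast
    ring

include hα in
theorem polyMap_charlier_touchard (n : ℕ) :
    polyMap (charlier α σ) (touchard α σ n) = X ^ n := by
  induction n with
  | zero => simpa [touchard_zero, charlier_zero] using polyMap_X_pow (charlier α σ) 0
  | succ n ih => rw [touchard_succ, polyMap_charlier_touchardOp hα, ih, pow_succ']

include hα in
theorem polyMap_charlier_polyMap_touchard (f : ℂ[X]) :
    polyMap (charlier α σ) (polyMap (touchard α σ) f) = f := by
  refine LinearMap.congr_fun (f := polyMap (charlier α σ) ∘ₗ polyMap (touchard α σ))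
    (g := LinearMap.id) (linearMap_ext_X_pow fun n => ?_) f
  rw [LinearMap.comp_apply, polyMap_X_pow, polyMap_charlier_touchard hα, LinearMap.id_apply]

theorem natDegree_touchard_le (n : ℕ) : (touchard α σ n).natDegree ≤ n := by
  induction n with
  | zero => simp [touchard]
  | succ n ih =>
    rw [touchard_succ, touchardOp_apply, add_comm n]
    refine natDegree_mul_le_of_le (natDegree_X_add_C _).le
      ((natDegree_add_le_of_degree_le ih ?_))
    exact (natDegree_C_mul_le _ _).trans ((natDegree_derivative_le _).trans (by omega))

/-! ### Factorial bounds and the automorphism of `EMin` -/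

variable (hσ : 0 < σ)

-- Each step applies `1 + α d/dz`, at a cost independent of the degree, and then `X + σ/α`, at cost
-- at most `(n+1)(R + σ/α)`. The factors `n+1` multiply to `n!`.
include hα hσ in
theorem isTame_touchard : EMin.IsTame (touchard α σ) := fun m => by
  set R : ℝ := ((m : ℕ) : ℝ)
  have hR0 : 0 < R := Nat.cast_pos.2 m.pos
  refine ⟨1, (R + σ / α) * (1 + α * R⁻¹), by positivity, by positivity, fun n => ?_⟩
  induction n with
  | zero => simpa [touchard] using (borelNorm_X_pow (R := R) 0).le
  | succ n ih =>
    set p := touchard α σ n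
    set q := p + C (α : ℂ) * derivative p with hq
    have hp0 := borelNorm_nonneg p hR0.le
    have hqd : q.natDegree ≤ n := natDegree_add_le_of_degree_le (natDegree_touchard_le n)
      ((natDegree_C_mul_le _ _).trans ((natDegree_derivative_le _).trans
        ((Nat.sub_le _ _).trans (natDegree_touchard_le n))))
    have h1 : borelNorm R q ≤ (1 + α * R⁻¹) * borelNorm R p := by
      refine (borelNorm_add_le _ _ hR0.le).trans ?_
      rw [borelNorm_C_mul, Complex.norm_real, Real.norm_of_nonneg hα.le]
      nlinarith [mul_le_mul_of_nonneg_left (borelNorm_derivative_le p hR0) hα.le]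
    have h2 : borelNorm R (touchard α σ (n + 1)) ≤ ((n + 1) * R + σ / α) * borelNorm R q := by
      rw [touchard_succ, touchardOp_apply, add_mul]
      refine (borelNorm_add_le _ _ hR0.le).trans ?_
      rw [borelNorm_C_mul, ← Complex.ofReal_div, Complex.norm_real,
        Real.norm_of_nonneg (by positivity), add_mul]
      exact add_le_add_left (borelNorm_X_mul_le q hR0.le hqd) _
    have h3 : ((n + 1) * R + σ / α) ≤ (n + 1) * (R + σ / α) := by
      have : 0 ≤ (n : ℝ) * (σ / α) := by positivity
      linarith
    calc borelNorm R (touchard α σ (n + 1)) ≤ ((n + 1) * R + σ / α) * borelNorm R q := h2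
      _ ≤ ((n + 1) * (R + σ / α)) * ((1 + α * R⁻¹) *
          (1 * ((R + σ / α) * (1 + α * R⁻¹)) ^ n * n !)) := by
        refine mul_le_mul h3 (h1.trans ?_) (borelNorm_nonneg _ hR0.le) (by positivity)
        gcongr
      _ = _ := by
        rw [Nat.factorial_succ, pow_succ]
        push_cast
        ring

-- The three-term recurrence is bounded directly: the step from `c_{n+1}` costs at most `(n+2) K`,
-- and the `c_n` term carries only `σ (n+1)`.
include hα hσ in
theorem isTame_charlier : EMin.IsTame (charlier α σ) := fun m => by
  set R : ℝ := ((m : ℕ) : ℝ)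
  have hR0 : 0 < R := Nat.cast_pos.2 m.pos
  set K : ℝ := R + σ / α + α with hK
  have hK0 : 0 < K := by positivity
  have hb : ∀ (n : ℕ) (p : ℂ[X]), p.natDegree ≤ n → borelNorm R (X * p - C (σ / α + α * n : ℂ) * p) ≤
      (n + 1) * K * borelNorm R p := fun n p hp => by
    have h0 := borelNorm_nonneg p hR0.le
    have h1 := borelNorm_X_mul_le p hR0.le hp
    have h2 : X * p - C (σ / α + α * n : ℂ) * p = X * p + C (-(σ / α + α * n) : ℂ) * p := by
      rw [C_neg]; ring
    have h3 : ‖(-(σ / α + α * n) : ℂ)‖ = σ / α + α * n := by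
      rw [norm_neg]
      have : (σ / α + α * n : ℂ) = ((σ / α + α * n : ℝ) : ℂ) := by push_cast; rfl
      rw [this, Complex.norm_real, Real.norm_of_nonneg (by positivity)]
    rw [h2]
    refine (borelNorm_add_le _ _ hR0.le).trans ?_
    rw [borelNorm_C_mul, h3]
    have h4 : 0 ≤ (n * (σ / α) + α) * borelNorm R p := by positivity
    rw [hK]
    linarith
  have h0 : borelNorm R (charlier α σ 0) = 1 := by
    simpa [charlier_zero] using (borelNorm_X_pow (R := R) 0)
  -- `K + σ` pays for the two terms of the recurrence; the extra `1` makes powers of the base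
  -- nondecreasing.
  refine ⟨1, K + σ + 1, by positivity, by positivity, fun n => ?_⟩
  induction n using Nat.twoStepInduction with
  | zero => simp [h0]
  | one =>
    have h1 := hb 0 (charlier α σ 0) (by simp [charlier_zero])
    have h2 : charlier α σ 1 = X * charlier α σ 0 - C (σ / α + α * (0 : ℕ) : ℂ) * charlier α σ 0 := by
      simp [charlier]
    rw [h2]
    refine h1.trans ?_
    rw [h0]
    simp
    linarith
  | more n ih0 ih1 =>
    have h1 := hb (n + 1) (charlier α σ (n + 1)) (charlier_monic_and_natDegree α σ (n + 1)).2.le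
    have h2 : borelNorm R (charlier α σ (n + 2)) ≤ (n + 2) * K * borelNorm R (charlier α σ (n + 1)) +
        σ * (n + 1) * borelNorm R (charlier α σ n) := by
      rw [charlier_succ_succ hα, sub_eq_add_neg, ← neg_mul, ← C_neg]
      refine (borelNorm_add_le _ _ hR0.le).trans ?_
      have h3 : ‖(-(σ * (n + 1)) : ℂ)‖ = σ * (n + 1) := by
        rw [norm_neg]
        have : (σ * (n + 1) : ℂ) = ((σ * (n + 1) : ℝ) : ℂ) := by push_cast; rfl
        rw [this, Complex.norm_real, Real.norm_of_nonneg (by positivity)]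
      rw [borelNorm_C_mul, h3]
      push_cast at h1
      rw [add_assoc (n : ℝ), one_add_one_eq_two] at h1
      linarith
    set M := K + σ + 1 with hM
    have hM0 : 0 < M := by positivity
    have hM1 : 1 ≤ M := by linarith
    calc borelNorm R (charlier α σ (n + 2))
        ≤ (n + 2) * K * (1 * M ^ (n + 1) * (n + 1)!) + σ * (n + 1) * (1 * M ^ n * n !) := by
          refine h2.trans ?_
          gcongr
      _ ≤ (n + 2) * K * (1 * M ^ (n + 1) * (n + 1)!) + σ * (n + 2) * (M ^ (n + 1) * (n + 1)!) := by
          rw [Nat.factorial_succ]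
          push_cast
          have : M ^ n ≤ M ^ (n + 1) := pow_le_pow_right₀ hM1 n.le_succ
          have h5 : 1 * M ^ n * n ! ≤ M ^ (n + 1) * ((n + 1) * n !) := by
            have : (n ! : ℝ) ≤ (n + 1) * n ! := by nlinarith [(Nat.cast_nonneg n : (0 : ℝ) ≤ n)]
            rw [one_mul]
            gcongr
          have h6 : σ * (n + 1) ≤ σ * ((n : ℝ) + 2) := by gcongr; norm_num
          exact add_le_add le_rfl (mul_le_mul h6 h5 (by positivity) (by positivity))
      _ = (K + σ) * (M ^ (n + 1) * (n + 2)!) := by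
          rw [Nat.factorial_succ (n + 1)]
          push_cast
          ring
      _ ≤ M * (M ^ (n + 1) * (n + 2)!) := by gcongr; linarith
      _ = _ := by ring

/-- The continuous linear automorphism of `EMin` with `charlier α σ n ↦ X ^ n`. -/
noncomputable def segalBargmannEquiv : EMin ≃L[ℂ] EMin :=
  ContinuousLinearEquiv.equivOfInverse (EMin.extend (isTame_touchard hα hσ))
    (EMin.extend (isTame_charlier hα hσ))
    (fun f => by
      refine congrArg (· f) (EMin.continuousLinearMap_ext
        (A := (EMin.extend (isTame_charlier hα hσ)).comp (EMin.extend (isTame_touchard hα hσ)))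
        (B := ContinuousLinearMap.id ℂ EMin) fun n => ?_)
      rw [ContinuousLinearMap.comp_apply, EMin.extend_ofPolynomial_X_pow,
        EMin.extend_ofPolynomial _ (polyMap_X_pow _), polyMap_charlier_touchard hα]
      rfl)
    (fun f => by
      refine congrArg (· f) (EMin.continuousLinearMap_ext
        (A := (EMin.extend (isTame_touchard hα hσ)).comp (EMin.extend (isTame_charlier hα hσ)))
        (B := ContinuousLinearMap.id ℂ EMin) fun n => ?_)
      rw [ContinuousLinearMap.comp_apply, EMin.extend_ofPolynomial_X_pow,
        EMin.extend_ofPolynomial _ (polyMap_X_pow _), polyMap_touchard_charlier hα]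
      rfl)

theorem segalBargmannEquiv_ofPolynomial (p : ℂ[X]) :
    segalBargmannEquiv hα hσ (EMin.ofPolynomial p) =
      EMin.ofPolynomial (polyMap (touchard α σ) p) :=
  EMin.extend_ofPolynomial (isTame_touchard hα hσ) (polyMap_X_pow _) p

end

/-! ### The Poisson measure: atoms, integrals and exponential moments -/

/-- The weight of `scaledPoisson α σ` at `α n`. -/
noncomputable def poissonWeight (α σ : ℝ) (n : ℕ) : ℝ :=
  Real.exp (-(σ / α ^ 2)) * ((1 / (n ! : ℝ)) * (σ / α ^ 2) ^ n)

/-- The point `α n` of `scaledNat α`. -/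
def scaledNat.mk (α : ℝ) (n : ℕ) : scaledNat α := ⟨α * n, n, rfl⟩

theorem scaledNat.forall {α : ℝ} {P : scaledNat α → Prop} : (∀ x, P x) ↔ ∀ n, P (mk α n) :=
  ⟨fun h n => h _, fun h x => by obtain ⟨_, n, rfl⟩ := x; exact h n⟩

instance (α : ℝ) : Countable (scaledNat α) := (Set.countable_range _).to_subtype

section weights

variable {α σ : ℝ}

theorem poissonWeight_pos (hα : 0 < α) (hσ : 0 < σ) (n : ℕ) : 0 < poissonWeight α σ n := by
  unfold poissonWeight; positivity

theorem scaledPoisson_eq : scaledPoisson α σ = Measure.sum fun n : ℕ =>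
    ENNReal.ofReal (poissonWeight α σ n) • Measure.dirac (scaledNat.mk α n) := rfl

variable (hα : 0 < α) (hσ : 0 < σ)

include hα in
theorem poissonWeight_succ (n : ℕ) :
    poissonWeight α σ (n + 1) * (α * (n + 1)) = σ / α * poissonWeight α σ n := by
  unfold poissonWeight
  rw [Nat.factorial_succ, pow_succ (σ / α ^ 2) n]
  push_cast
  field_simp

theorem summable_poissonWeight_mul_pow (r : ℝ) :
    Summable fun n => poissonWeight α σ n * r ^ n := by
  refine ((Real.summable_pow_div_factorial (σ / α ^ 2 * r)).mul_left
    (Real.exp (-(σ / α ^ 2)))).congr fun n => ?_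
  rw [poissonWeight, mul_pow]
  ring

theorem tsum_poissonWeight : ∑' n, poissonWeight α σ n = 1 := by
  have h : ∑' n : ℕ, (σ / α ^ 2) ^ n / (n ! : ℝ) = Real.exp (σ / α ^ 2) := by
    rw [Real.exp_eq_exp_ℝ, NormedSpace.exp_eq_tsum_div]
  have h2 : ∀ n, poissonWeight α σ n =
      Real.exp (-(σ / α ^ 2)) * ((σ / α ^ 2) ^ n / (n ! : ℝ)) := fun n => by
    rw [poissonWeight]; ring
  simp only [h2]
  rw [tsum_mul_left, h, ← Real.exp_add, neg_add_cancel, Real.exp_zero]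

include hα hσ

/-- Every atom has positive mass, so only the empty set is null and `L²` classes have genuine point
values. -/
theorem ae_scaledPoisson_iff {P : scaledNat α → Prop} :
    (∀ᵐ x ∂scaledPoisson α σ, P x) ↔ ∀ x, P x := by
  rw [scaledPoisson_eq, Measure.ae_sum_iff, scaledNat.forall]
  refine forall_congr' fun n => ?_
  have h : ENNReal.ofReal (poissonWeight α σ n) ≠ 0 := by simpa using poissonWeight_pos hα hσ n
  rw [Measure.ae_ennreal_smul_measure_iff h, ae_dirac_eq]
  rfl

theorem integrable_scaledPoisson_iff {E : Type*} [NormedAddCommGroup E] {f : scaledNat α → E} :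
    Integrable f (scaledPoisson α σ) ↔
      Summable fun n => poissonWeight α σ n * ‖f (scaledNat.mk α n)‖ := by
  rw [scaledPoisson_eq, integrable_sum_dirac_iff fun _ => ENNReal.ofReal_ne_top]
  simp only [ENNReal.toReal_ofReal (poissonWeight_pos hα hσ _).le]

theorem integral_scaledPoisson (f : scaledNat α → ℂ) :
    ∫ x, f x ∂scaledPoisson α σ = ∑' n, (poissonWeight α σ n : ℂ) * f (scaledNat.mk α n) := by
  rw [scaledPoisson_eq, integral_sum_dirac fun _ => ENNReal.ofReal_ne_top]
  simp only [ENNReal.toReal_ofReal (poissonWeight_pos hα hσ _).le, Complex.real_smul]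

omit hα hσ in
theorem aestronglyMeasurable_scaledPoisson {E : Type*} [NormedAddCommGroup E]
    (f : scaledNat α → E) : AEStronglyMeasurable f (scaledPoisson α σ) :=
  (StronglyMeasurable.of_discrete).aestronglyMeasurable

theorem summable_of_le_exp {f : ℂ → ℂ} {C t : ℝ} (h : ∀ z, ‖f z‖ ≤ C * Real.exp (t * ‖z‖)) :
    Summable fun n : ℕ => poissonWeight α σ n * ‖f ((α * n : ℝ) : ℂ)‖ := by
  refine Summable.of_nonneg_of_le
    (fun n => mul_nonneg (poissonWeight_pos hα hσ n).le (norm_nonneg _)) (fun n => ?_)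
    ((summable_poissonWeight_mul_pow (α := α) (σ := σ) (Real.exp (t * α))).mul_left C)
  have h1 := h ((α * n : ℝ) : ℂ)
  rw [Complex.norm_real, Real.norm_of_nonneg (by positivity)] at h1
  rw [mul_left_comm, ← Real.exp_nat_mul]
  have h2 : (n : ℝ) * (t * α) = t * (α * n) := by ring
  rw [h2]
  have := (poissonWeight_pos hα hσ n).le
  gcongr

theorem memLp_two_of_le_exp {f : ℂ → ℂ} {C t : ℝ} (h : ∀ z, ‖f z‖ ≤ C * Real.exp (t * ‖z‖)) :
    MemLp (fun x : scaledNat α => f ((x : ℝ) : ℂ)) 2 (scaledPoisson α σ) := by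
  rw [memLp_two_iff_integrable_sq_norm (aestronglyMeasurable_scaledPoisson _),
    integrable_scaledPoisson_iff hα hσ]
  have h2 : ∀ z, ‖f z ^ 2‖ ≤ C ^ 2 * Real.exp ((2 * t) * ‖z‖) := fun z => by
    rw [norm_pow, mul_assoc, two_mul, Real.exp_add, ← sq, ← mul_pow]
    exact pow_le_pow_left₀ (norm_nonneg _) (h z) 2
  refine (summable_of_le_exp hα hσ h2).congr fun n => ?_
  rw [norm_pow, norm_pow, norm_norm]
  rfl

omit hα hσ in
theorem EMin.norm_apply_le_exp (f : EMin) (z : ℂ) :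
    ‖f z‖ ≤ expNorm 1 f * Real.exp (1 * ‖z‖) := by
  simpa using norm_apply_le f 1 z

theorem EMin.memLp (f : EMin) :
    MemLp (fun x : scaledNat α => f ((x : ℝ) : ℂ)) 2 (scaledPoisson α σ) :=
  memLp_two_of_le_exp hα hσ (f.norm_apply_le_exp)

end weights

/-! ### Restriction from `EMin` to `L²` -/

namespace EMin

variable {α σ : ℝ} (hα : 0 < α) (hσ : 0 < σ)

/-- Restriction to `scaledNat α`, as a linear map. -/
noncomputable def restrictₗ : EMin →ₗ[ℂ] Lp ℂ 2 (scaledPoisson α σ) where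
  toFun f := (f.memLp hα hσ).toLp
  map_add' _ _ := rfl
  map_smul' _ _ := rfl

theorem restrictₗ_apply (f : EMin) (x : scaledNat α) : restrictₗ hα hσ f x = f ((x : ℝ) : ℂ) :=
  (ae_scaledPoisson_iff hα hσ).1 (f.memLp hα hσ).coeFn_toLp x

/-- Restriction to `scaledNat α`, as a continuous linear map. -/
noncomputable def restrict : EMin →L[ℂ] Lp ℂ 2 (scaledPoisson α σ) :=
  ⟨restrictₗ hα hσ, withSeminorms.continuous_of_isBounded (norm_withSeminorms ℂ _) _ fun _ => by
    -- The function `exp |x|` is in `L²` and dominates `f` up to the factor `expNorm 1 f`, so one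
    -- seminorm suffices for continuity.
    have hg : ∀ z : ℂ, ‖((Real.exp ‖z‖ : ℝ) : ℂ)‖ ≤ 1 * Real.exp (1 * ‖z‖) := fun z => by
      rw [Complex.norm_real, Real.norm_of_nonneg (Real.exp_pos _).le, one_mul, one_mul]
    set g := (memLp_two_of_le_exp (σ := σ) hα hσ hg).toLp
    refine ⟨{1}, ‖g‖.toNNReal, fun f => ?_⟩
    simp only [Seminorm.comp_apply, coe_normSeminorm, Finset.sup_singleton, _root_.smul_apply]
    rw [NNReal.smul_def, Real.coe_toNNReal _ (norm_nonneg _), smul_eq_mul, mul_comm]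
    refine Lp.norm_le_mul_norm_of_ae_le_mul ((ae_scaledPoisson_iff hα hσ).2 fun x => ?_)
    have h1 : g x = ((Real.exp ‖((x : ℝ) : ℂ)‖ : ℝ) : ℂ) :=
      (ae_scaledPoisson_iff hα hσ).1 (memLp_two_of_le_exp (σ := σ) hα hσ hg).coeFn_toLp x
    rw [restrictₗ_apply, h1, Complex.norm_real, Real.norm_of_nonneg (Real.exp_pos _).le]
    simpa using f.norm_apply_le 1 ((x : ℝ) : ℂ)⟩

theorem restrict_apply (f : EMin) (x : scaledNat α) : restrict hα hσ f x = f ((x : ℝ) : ℂ) :=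
  restrictₗ_apply hα hσ f x

end EMin

/-! ### Orthogonality and uniqueness of the monic sequence -/

section inner

variable {α σ : ℝ} (hα : 0 < α) (hσ : 0 < σ)

theorem inner_eq_integral (f g : Lp ℂ 2 (scaledPoisson α σ)) :
    inner ℂ g f = ∫ x, f x * conj (g x) ∂scaledPoisson α σ := by
  rw [L2.inner_def]
  rfl

/-- The integral of a polynomial with respect to `scaledPoisson α σ`. -/
noncomputable def poissonIntegral (α σ : ℝ) (p : ℂ[X]) : ℂ :=
  ∑' n : ℕ, (poissonWeight α σ n : ℂ) * p.eval ((α * n : ℝ) : ℂ)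

include hα hσ

theorem inner_restrict (p q : ℂ[X]) (hq : ∀ x : ℝ, conj (q.eval (x : ℂ)) = q.eval (x : ℂ)) :
    inner ℂ (EMin.restrict hα hσ (EMin.ofPolynomial q))
      (EMin.restrict hα hσ (EMin.ofPolynomial p)) = poissonIntegral α σ (p * q) := by
  rw [inner_eq_integral, integral_scaledPoisson hα hσ]
  refine tsum_congr fun n => ?_
  rw [EMin.restrict_apply, EMin.restrict_apply, EMin.ofPolynomial_apply, EMin.ofPolynomial_apply,
    hq, eval_mul]
  rfl

theorem summable_poissonIntegral (p : ℂ[X]) :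
    Summable fun n : ℕ => (poissonWeight α σ n : ℂ) * p.eval ((α * n : ℝ) : ℂ) := by
  refine Summable.of_norm ?_
  refine (summable_of_le_exp hα hσ
    ((EMin.ofPolynomial p).norm_apply_le_exp)).congr fun n => ?_
  rw [norm_mul, Complex.norm_real, Real.norm_of_nonneg (poissonWeight_pos hα hσ n).le]
  rfl

theorem poissonIntegral_sub (p q : ℂ[X]) :
    poissonIntegral α σ (p - q) = poissonIntegral α σ p - poissonIntegral α σ q := by
  unfold poissonIntegral
  rw [← (summable_poissonIntegral hα hσ p).tsum_sub (summable_poissonIntegral hα hσ q)]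
  simp only [eval_sub, mul_sub]

omit hα hσ in
theorem poissonIntegral_C_mul (a : ℂ) (p : ℂ[X]) :
    poissonIntegral α σ (C a * p) = a * poissonIntegral α σ p := by
  unfold poissonIntegral
  rw [← tsum_mul_left]
  simp only [eval_mul, eval_C, mul_left_comm]

/-- Poisson integration by parts: the factor `X` kills the atom at `0`, and the ratio of consecutive
weights shifts the rest by one. -/
theorem poissonIntegral_X_mul (p : ℂ[X]) : poissonIntegral α σ (X * p) =
    σ / α * poissonIntegral α σ (p.comp (X + C (α : ℂ))) := by
  unfold poissonIntegral
  rw [(summable_poissonIntegral hα hσ _).tsum_eq_zero_add, ← tsum_mul_left]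
  simp only [eval_mul, eval_X, CharP.cast_eq_zero, mul_zero, Complex.ofReal_zero, zero_mul,
    zero_add]
  refine tsum_congr fun n => ?_
  have h : (poissonWeight α σ (n + 1) : ℂ) * (α * (n + 1)) = σ / α * poissonWeight α σ n := by
    exact_mod_cast poissonWeight_succ (σ := σ) hα n
  rw [eval_comp, eval_add, eval_X, eval_C]
  push_cast
  rw [← mul_assoc, h, mul_add_one]
  ring

/-- Adjointness of raising and forward difference: integration by parts moves the shift in the
raising relation onto `q`. -/
theorem poissonIntegral_charlier_succ_mul (n : ℕ) (q : ℂ[X]) :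
    poissonIntegral α σ (charlier α σ (n + 1) * q) =
      σ / α * poissonIntegral α σ (charlier α σ n * (q.comp (X + C (α : ℂ)) - q)) := by
  have h1 : charlier α σ (n + 1) * q =
      X * ((charlier α σ n).comp (X - C (α : ℂ)) * q) -
        C (σ / α : ℂ) * (charlier α σ n * q) := by
    rw [charlier]; ring
  have h2 : ((charlier α σ n).comp (X - C (α : ℂ))).comp (X + C (α : ℂ)) = charlier α σ n := by
    rw [comp_assoc]; simp
  rw [h1, poissonIntegral_sub hα hσ, poissonIntegral_X_mul hα hσ, poissonIntegral_C_mul, mul_comp,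
    h2, mul_sub (charlier α σ n), poissonIntegral_sub hα hσ]
  ring

/-- Adjointness and lowering reduce both indices by one at the cost `(σ/α) · α (n+1) = σ (n+1)`,
until one index is `0`. A constant has zero difference, and the total mass is `1`. -/
theorem poissonIntegral_charlier_mul_charlier (m n : ℕ) :
    poissonIntegral α σ (charlier α σ m * charlier α σ n) =
      if m = n then (n ! : ℂ) * (σ : ℂ) ^ n else 0 := by
  have hα' : (α : ℂ) ≠ 0 := by exact_mod_cast hα.ne'
  have h0 : ∀ n, poissonIntegral α σ (charlier α σ (n + 1) * charlier α σ 0) = 0 := fun n => by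
    rw [poissonIntegral_charlier_succ_mul hα hσ, charlier_zero, one_comp, sub_self, mul_zero]
    simp [poissonIntegral]
  induction m generalizing n with
  | zero =>
    rcases n with _ | n
    · have h : ((∑' n, poissonWeight α σ n : ℝ) : ℂ) = 1 := by rw [tsum_poissonWeight]; simp
      rw [Complex.ofReal_tsum] at h
      simpa [charlier_zero, poissonIntegral] using h
    · rw [mul_comm, h0, if_neg (by omega)]
  | succ m ih =>
    rcases n with _ | n
    · rw [h0, if_neg (by omega)]
    · have h : (charlier α σ (n + 1)).comp (X + C (α : ℂ)) - charlier α σ (n + 1) =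
          C (α * (n + 1) : ℂ) * charlier α σ n := by
        refine Polynomial.funext fun x => ?_
        simp only [eval_sub, eval_comp, eval_add, eval_X, eval_C, eval_mul, charlier_eval_add]
        ring
      rw [poissonIntegral_charlier_succ_mul hα hσ, h, mul_left_comm, poissonIntegral_C_mul, ih]
      by_cases hmn : m = n
      · rw [if_pos hmn, if_pos (by omega), Nat.factorial_succ]
        push_cast
        field_simp
        ring
      · rw [if_neg hmn, if_neg (by omega)]
        ring

/-- The Charlier polynomial of degree `n`, as an element of `L²`. -/
noncomputable def charlierLp (n : ℕ) : Lp ℂ 2 (scaledPoisson α σ) :=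
  EMin.restrict hα hσ (EMin.ofPolynomial (charlier α σ n))

theorem inner_charlierLp (m n : ℕ) : inner ℂ (charlierLp hα hσ m) (charlierLp hα hσ n) =
    if m = n then (n ! : ℂ) * (σ : ℂ) ^ n else 0 := by
  rw [charlierLp, charlierLp, inner_restrict hα hσ _ _ fun x => conj_charlier_eval m x, mul_comm,
    poissonIntegral_charlier_mul_charlier hα hσ]

theorem inner_restrict_ofPolynomial (p q : ℂ[X]) :
    inner ℂ (EMin.restrict hα hσ (EMin.ofPolynomial q))
      (EMin.restrict hα hσ (EMin.ofPolynomial p)) =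
    ∫ x : scaledNat α, p.eval ((x : ℝ) : ℂ) * conj (q.eval ((x : ℝ) : ℂ)) ∂scaledPoisson α σ := by
  rw [inner_eq_integral]
  simp only [EMin.restrict_apply, EMin.ofPolynomial_apply]

theorem isMonicOrthogonalSeq_charlier : IsMonicOrthogonalSeq α σ (charlier α σ) where
  monic n := (charlier_monic_and_natDegree α σ n).1
  natDegree_eq n := (charlier_monic_and_natDegree α σ n).2
  orthogonal m n hmn := by
    rw [← inner_restrict_ofPolynomial hα hσ]
    exact (inner_charlierLp hα hσ n m).trans (if_neg hmn.symm)

-- Charlier polynomials are monic with one in each degree, so leading terms can be peeled off. The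
-- cutoff at `n` matters in the uniqueness argument, where only lower indices are under control.
omit hα hσ in
theorem eq_zero_of_charlier_eq_zero {M : Type*} [AddCommGroup M] [Module ℂ M] (B : ℂ[X] →ₗ[ℂ] M)
    (n : ℕ) (hB : ∀ k < n, B (charlier α σ k) = 0) (d : ℂ[X]) (hd : d.degree < n) : B d = 0 := by
  induction n generalizing d with
  | zero =>
    rw [degree_lt_iff_coeff_zero] at hd
    rw [show d = 0 from Polynomial.ext fun k => hd k k.zero_le, map_zero]
  | succ n ih =>
    obtain ⟨h1, h2⟩ := charlier_monic_and_natDegree α σ n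
    have h3 : (d - d.coeff n • charlier α σ n).degree < n := by
      rw [degree_lt_iff_coeff_zero] at hd ⊢
      intro k hk
      rw [coeff_sub, coeff_smul, smul_eq_mul]
      rcases hk.eq_or_lt with rfl | hk
      · have h4 := h1.coeff_natDegree
        rw [h2] at h4
        rw [h4, mul_one, sub_self]
      · rw [hd k hk, coeff_eq_zero_of_natDegree_lt (p := charlier α σ n) (by omega), mul_zero,
          sub_zero]
    have h4 := ih (fun k hk => hB k (by omega)) _ h3
    rwa [map_sub, map_smul, hB n n.lt_succ_self, smul_zero, sub_zero] at h4

theorem eq_zero_of_restrict_ofPolynomial_eq_zero (d : ℂ[X])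
    (h : EMin.restrict hα hσ (EMin.ofPolynomial d) = 0) : d = 0 := by
  refine eq_zero_of_infinite_isRoot d (Set.infinite_of_injective_forall_mem
    (f := fun n : ℕ => ((α * n : ℝ) : ℂ)) (fun m n hmn => ?_) fun n => ?_)
  · have : α * m = α * n := Complex.ofReal_injective hmn
    exact_mod_cast mul_left_cancel₀ hα.ne' this
  · have h1 := EMin.restrict_apply hα hσ (EMin.ofPolynomial d) (scaledNat.mk α n)
    rw [h] at h1
    have h2 : (0 : Lp ℂ 2 (scaledPoisson α σ)) (scaledNat.mk α n) = 0 :=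
      (ae_scaledPoisson_iff hα hσ).1 (Lp.coeFn_zero _ _ _) _
    exact h1.symm.trans h2

/-- By strong induction, the difference of the two degree-`n` members has degree below `n`. It is
therefore orthogonal to both members, hence to itself, and a polynomial vanishing on all of `αℕ₀` is
zero. -/
theorem IsMonicOrthogonalSeq.eq_charlier {c : ℕ → ℂ[X]} (hc : IsMonicOrthogonalSeq α σ c) :
    c = charlier α σ := by
  funext n
  induction n using Nat.strong_induction_on with
  | _ n ih =>
    obtain ⟨h1, h2⟩ := charlier_monic_and_natDegree α σ n
    have hdeg : (c n - charlier α σ n).degree < n := by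
      have h3 : (c n).degree = n := by
        rw [degree_eq_natDegree (hc.monic n).ne_zero, hc.natDegree_eq]
      have h4 : (charlier α σ n).degree = n := by rw [degree_eq_natDegree h1.ne_zero, h2]
      have := degree_sub_lt_left (h3.trans h4.symm) (hc.monic n).ne_zero
        ((hc.monic n).leadingCoeff.trans h1.leadingCoeff.symm)
      rwa [h3] at this
    let ρ : ℂ[X] →ₗ[ℂ] Lp ℂ 2 (scaledPoisson α σ) :=
      (EMin.restrict hα hσ).toLinearMap ∘ₗ EMin.ofPolynomial
    have hρ : ∀ p q, inner ℂ (ρ q) (ρ p) =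
        ∫ x : scaledNat α, p.eval ((x : ℝ) : ℂ) * conj (q.eval ((x : ℝ) : ℂ))
          ∂scaledPoisson α σ := inner_restrict_ofPolynomial hα hσ
    have key : ∀ q : ℂ[X], (∀ k < n, inner ℂ (ρ q) (ρ (charlier α σ k)) = 0) →
        inner ℂ (ρ q) (ρ (c n - charlier α σ n)) = 0 := fun q hq =>
      eq_zero_of_charlier_eq_zero ((innerSL ℂ (ρ q)).toLinearMap ∘ₗ ρ) n hq _ hdeg
    have k1 := key (c n) fun k hk => by
      rw [hρ, ← ih k hk]
      exact hc.orthogonal k n hk.ne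
    have k2 := key (charlier α σ n) fun k hk => by
      rw [hρ]
      exact (isMonicOrthogonalSeq_charlier hα hσ).orthogonal k n hk.ne
    have k3 : inner ℂ (ρ (c n - charlier α σ n)) (ρ (c n - charlier α σ n)) = 0 := by
      conv_lhs => rw [map_sub ρ, inner_sub_left]
      rw [← map_sub ρ, k1, k2, sub_zero]
    exact sub_eq_zero.1 (eq_zero_of_restrict_ofPolynomial_eq_zero hα hσ _
      (inner_self_eq_zero.1 k3))

end inner

/-! ### Completeness of the Charlier polynomials -/

/-- A sequence all of whose binomial moments vanish is zero, if it decays faster than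
exponentially. -/
theorem eq_zero_of_tsum_mul_choose_eq_zero {h : ℕ → ℂ} (hs : ∀ r : ℝ, Summable fun k => ‖h k‖ * r ^ k)
    (h0 : ∀ n, ∑' k, h k * (k.choose n : ℂ) = 0) (k : ℕ) : h k = 0 := by
  -- The entire function `∑ h_k z^k`, re-expanded about `z = 1`, has the binomial moments as
  -- coefficients, so it vanishes identically.
  have hsum : ∀ z : ℂ, HasSum (fun k => h k * z ^ k) 0 := fun z => by
    have hz : Summable fun k => h k * z ^ k := by
      refine Summable.of_norm ((hs ‖z‖).congr fun k => ?_)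
      rw [norm_mul, norm_pow]
    have hfin : ∀ {E : Type} [AddCommMonoid E] [TopologicalSpace E] (k : ℕ) (u : ℕ → E),
        (∀ n, k < n → u n = 0) → HasSum u (∑ n ∈ Finset.range (k + 1), u n) :=
      fun k u hu => hasSum_sum_of_ne_finset_zero fun n hn => hu n (by simpa using hn)
    have hrow : ∀ k, HasSum (fun n => h k * (k.choose n : ℂ) * (z - 1) ^ n) (h k * z ^ k) :=
      fun k => by
        convert hfin k (fun n => h k * (k.choose n : ℂ) * (z - 1) ^ n) fun n hn => by
          simp [Nat.choose_eq_zero_of_lt hn] using 1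
        have := add_pow (z - 1) 1 k
        rw [sub_add_cancel] at this
        rw [this, Finset.mul_sum]
        exact Finset.sum_congr rfl fun n _ => by rw [one_pow]; ring
    have hrow' : ∀ k, HasSum (fun n => ‖h k * (k.choose n : ℂ) * (z - 1) ^ n‖)
        (‖h k‖ * (‖z - 1‖ + 1) ^ k) := fun k => by
      convert hfin k (fun n => ‖h k * (k.choose n : ℂ) * (z - 1) ^ n‖) fun n hn => by
        simp [Nat.choose_eq_zero_of_lt hn] using 1
      rw [add_pow, Finset.mul_sum]
      exact Finset.sum_congr rfl fun n _ => by
        rw [norm_mul, norm_mul, norm_pow, Complex.norm_natCast, one_pow]; ring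
    -- The absolute row sums are `‖h k‖ (‖z - 1‖ + 1)^k`, summable by hypothesis; this licenses the
    -- exchange of summation.
    have hprod : Summable (Function.uncurry fun k n => h k * (k.choose n : ℂ) * (z - 1) ^ n) := by
      refine Summable.of_norm ((summable_prod_of_nonneg fun _ => norm_nonneg _).2
        ⟨fun k => (hrow' k).summable, ?_⟩)
      exact (hs (‖z - 1‖ + 1)).congr fun k => (hrow' k).tsum_eq.symm
    have h1 : ∑' k, h k * z ^ k = 0 := by
      calc ∑' k, h k * z ^ k = ∑' k, ∑' n, h k * (k.choose n : ℂ) * (z - 1) ^ n :=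
            tsum_congr fun k => (hrow k).tsum_eq.symm
        _ = ∑' n, ∑' k, h k * (k.choose n : ℂ) * (z - 1) ^ n := hprod.tsum_comm.symm
        _ = 0 := by simp only [tsum_mul_right, h0, zero_mul, tsum_zero]
    rw [← h1]
    exact hz.hasSum
  have h1 := (differentiable_and_taylorCoeff_of_hasSum (f := fun _ => 0) hsum).2 k
  have h2 := (differentiable_and_taylorCoeff_of_hasSum (a := 0) (f := fun _ => 0) fun z => by
    simp).2 k
  rw [← h1, h2, Pi.zero_apply]

section basis

variable {α σ : ℝ} (hα : 0 < α) (hσ : 0 < σ)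

-- A function orthogonal to all Charlier polynomials is orthogonal to all polynomials, so its
-- weighted conjugate values have vanishing binomial moments.
include hα hσ in
theorem eq_zero_of_inner_charlierLp_eq_zero (g : Lp ℂ 2 (scaledPoisson α σ))
    (h : ∀ n, inner ℂ (charlierLp hα hσ n) g = 0) : g = 0 := by
  have hw := poissonWeight_pos (α := α) (σ := σ) hα hσ
  set v : ℕ → ℂ := fun k => poissonWeight α σ k * conj (g (scaledNat.mk α k)) with hv
  have hpoly : ∀ p : ℂ[X], ∑' k : ℕ, v k * p.eval ((α * k : ℝ) : ℂ) = 0 := fun p => by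
    have h1 := eq_zero_of_charlier_eq_zero (α := α) (σ := σ)
      ((innerSL ℂ g).toLinearMap ∘ₗ (EMin.restrict hα hσ).toLinearMap ∘ₗ EMin.ofPolynomial)
      (p.natDegree + 1) (fun k _ => inner_eq_zero_symm.1 (h k)) p
      (degree_le_natDegree.trans_lt (by exact_mod_cast p.natDegree.lt_succ_self))
    have h2 : inner ℂ g (EMin.restrict hα hσ (EMin.ofPolynomial p)) = 0 := h1
    rw [inner_eq_integral, integral_scaledPoisson hα hσ] at h2
    rw [← h2]
    refine tsum_congr fun k => ?_
    rw [EMin.restrict_apply, EMin.ofPolynomial_apply, hv]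
    simp only [scaledNat.mk]
    ring
  have hgs : Summable fun k => poissonWeight α σ k * ‖g (scaledNat.mk α k)‖ ^ 2 := by
    have := (memLp_two_iff_integrable_sq_norm (Lp.aestronglyMeasurable g)).1 (Lp.memLp g)
    refine ((integrable_scaledPoisson_iff hα hσ).1 this).congr fun k => ?_
    rw [norm_pow, norm_norm]
  -- The elementary bound `|g| |r|^k ≤ |g|² + r^(2k)` splits this into square integrability of `g`
  -- and an exponential moment.
  have hvs : ∀ r : ℝ, Summable fun k => ‖v k‖ * r ^ k := fun r => by
    refine Summable.of_norm_bounded (hgs.add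
      (summable_poissonWeight_mul_pow (α := α) (σ := σ) (r ^ 2))) fun k => ?_
    rw [norm_mul, norm_norm, hv, norm_mul, Complex.norm_real, Real.norm_of_nonneg (hw k).le,
      RCLike.norm_conj, mul_assoc, ← mul_add, norm_pow, ← pow_mul, mul_comm 2 k, pow_mul]
    refine mul_le_mul_of_nonneg_left ?_ (hw k).le
    have h3 : (r ^ k) ^ 2 = (‖r‖ ^ k) ^ 2 := by rw [← norm_pow, Real.norm_eq_abs, sq_abs]
    rw [h3]
    nlinarith [sq_nonneg (‖g (scaledNat.mk α k)‖ - ‖r‖ ^ k), norm_nonneg (g (scaledNat.mk α k)),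
      pow_nonneg (norm_nonneg r) k]
  have hv0 := eq_zero_of_tsum_mul_choose_eq_zero hvs fun n => by
    -- The falling factorial of `x/α`, divided by `n!`, takes the value `k.choose n` at `x = α k`.
    have h1 := hpoly (C ((n ! : ℂ)⁻¹) * (descPochhammer ℂ n).comp (C ((α : ℂ)⁻¹) * X))
    rw [← h1]
    refine tsum_congr fun k => ?_
    have hα' : (α : ℂ) ≠ 0 := by exact_mod_cast hα.ne'
    rw [Nat.cast_choose_eq_descPochhammer_div, eval_mul, eval_C, eval_comp, eval_mul, eval_C,
      eval_X, Complex.ofReal_mul, inv_mul_cancel_left₀ hα', Complex.ofReal_natCast, div_eq_inv_mul]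
  refine Lp.ext ((ae_scaledPoisson_iff hα hσ).2 (scaledNat.forall.2 fun k => ?_))
  have h1 : (poissonWeight α σ k : ℂ) ≠ 0 := by exact_mod_cast (hw k).ne'
  have h2 : (0 : Lp ℂ 2 (scaledPoisson α σ)) (scaledNat.mk α k) = 0 :=
    (ae_scaledPoisson_iff hα hσ).1 (Lp.coeFn_zero _ _ _) _
  rw [h2]
  simpa using (mul_eq_zero.1 (hv0 k)).resolve_left h1

/-- The norm of `z ^ n` in `bargmannSpace σ`. -/
noncomputable def bargmannWeight (σ : ℝ) (n : ℕ) : ℝ := √(n ! * σ ^ n)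

include hσ in
theorem bargmannWeight_pos (n : ℕ) : 0 < bargmannWeight σ n := Real.sqrt_pos.2 (by positivity)

include hσ in
theorem bargmannWeight_sq (n : ℕ) : bargmannWeight σ n ^ 2 = n ! * σ ^ n :=
  Real.sq_sqrt (by positivity)

theorem orthonormal_charlierLp :
    Orthonormal ℂ fun n => ((bargmannWeight σ n : ℂ)⁻¹) • charlierLp hα hσ n := by
  rw [orthonormal_iff_ite]
  intro m n
  rw [inner_smul_left, inner_smul_right, inner_charlierLp]
  split_ifs with hmn
  · subst hmn
    have h1 : (bargmannWeight σ m : ℂ) ≠ 0 := by exact_mod_cast (bargmannWeight_pos hσ m).ne'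
    have h2 : (bargmannWeight σ m : ℂ) ^ 2 = m ! * (σ : ℂ) ^ m := by
      exact_mod_cast congrArg Complex.ofReal (bargmannWeight_sq hσ m)
    rw [← h2, map_inv₀, Complex.conj_ofReal]
    field_simp
  · simp

/-- The Hilbert basis of normalized Charlier polynomials. -/
noncomputable def charlierBasis : HilbertBasis ℕ ℂ (Lp ℂ 2 (scaledPoisson α σ)) :=
  HilbertBasis.mkOfOrthogonalEqBot (orthonormal_charlierLp hα hσ) <| by
    rw [Submodule.eq_bot_iff]
    intro g hg
    refine eq_zero_of_inner_charlierLp_eq_zero hα hσ g fun n => ?_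
    have h1 := (Submodule.mem_orthogonal _ _).1 hg _ (Submodule.subset_span ⟨n, rfl⟩)
    have h2 : (bargmannWeight σ n : ℂ) ≠ 0 := by exact_mod_cast (bargmannWeight_pos hσ n).ne'
    rw [inner_smul_left] at h1
    exact (mul_eq_zero.1 h1).resolve_left (by simpa using h2)

theorem charlierBasis_repr (g : Lp ℂ 2 (scaledPoisson α σ)) (n : ℕ) :
    (charlierBasis hα hσ).repr g n =
      (bargmannWeight σ n : ℂ)⁻¹ * inner ℂ (charlierLp hα hσ n) g := by
  rw [HilbertBasis.repr_apply_apply, charlierBasis, HilbertBasis.coe_mkOfOrthogonalEqBot,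
    inner_smul_left, map_inv₀, Complex.conj_ofReal]

end basis

/-! ### The Bargmann space as a weighted `ℓ²` space -/

section bargmann

variable {σ : ℝ} (hσ : 0 < σ)

theorem memlp_two_iff {a : ℕ → ℂ} : Memℓp a 2 ↔ Summable fun n => ‖a n‖ ^ 2 := by
  rw [memℓp_gen_iff (by simp)]
  simp

/-- The isomorphism of `bargmannSpace σ` with `ℓ²`, as a linear map. -/
noncomputable def bargmannToL2ₗ : bargmannSpace σ →ₗ[ℂ] lp (fun _ : ℕ => ℂ) 2 where
  toFun f := ⟨fun n => bargmannWeight σ n * taylorCoeff f n, memlp_two_iff.2 <|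
    f.2.2.congr fun n => by
      rw [norm_mul, Complex.norm_real, mul_pow, Real.norm_eq_abs, sq_abs, bargmannWeight_sq hσ,
        mul_comm]⟩
  map_add' f g := by
    refine lp.ext (funext fun n => ?_)
    exact (congrArg _ (taylorCoeff_add f.2.1 g.2.1 n)).trans (mul_add _ _ _)
  map_smul' a f := by
    refine lp.ext (funext fun n => ?_)
    exact (congrArg _ (taylorCoeff_smul f.2.1 a n)).trans (mul_left_comm _ _ _)

theorem bargmannToL2ₗ_apply (f : bargmannSpace σ) (n : ℕ) :
    bargmannToL2ₗ hσ f n = bargmannWeight σ n * taylorCoeff f n := rfl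

theorem bargmannToL2ₗ_bijective : Function.Bijective (bargmannToL2ₗ hσ) := by
  have hne : ∀ n, (bargmannWeight σ n : ℂ) ≠ 0 := fun n => by
    exact_mod_cast (bargmannWeight_pos hσ n).ne'
  refine ⟨fun f g hfg => Subtype.ext (eq_of_taylorCoeff_eq f.2.1 g.2.1 fun n => ?_), fun a => ?_⟩
  · have h := congrArg (fun b : lp (fun _ : ℕ => ℂ) 2 => b n) hfg
    exact mul_left_cancel₀ (hne n) h
  · have ha := memlp_two_iff.1 (lp.memℓp a)
    set b : ℕ → ℂ := fun n => (bargmannWeight σ n : ℂ)⁻¹ * a n with hb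
    -- Surjectivity needs an entire function. The product of `|a_n|` and `|z|^n / bargmannWeight σ
    -- n` is at most the sum of their squares, and the second squares form an exponential series in
    -- `|z|²/σ`.
    have hs : ∀ z : ℂ, Summable fun n => b n * z ^ n := fun z => by
      refine Summable.of_norm_bounded (ha.add
        (Real.summable_pow_div_factorial (‖z‖ ^ 2 / σ))) fun n => ?_
      have h1 : (‖z‖ ^ 2 / σ) ^ n / n ! = ((bargmannWeight σ n)⁻¹ * ‖z‖ ^ n) ^ 2 := by
        rw [mul_pow, inv_pow, bargmannWeight_sq hσ, div_pow, ← pow_mul, ← pow_mul, mul_comm 2 n]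
        field_simp
      rw [h1, hb, norm_mul, norm_mul, norm_inv, Complex.norm_real,
        Real.norm_of_nonneg (bargmannWeight_pos hσ n).le, norm_pow, mul_right_comm]
      have h2 := (bargmannWeight_pos hσ n).le
      nlinarith [sq_nonneg ((bargmannWeight σ n)⁻¹ * ‖z‖ ^ n - ‖a n‖), norm_nonneg (a n),
        mul_nonneg (inv_nonneg.2 h2) (pow_nonneg (norm_nonneg z) n)]
    obtain ⟨hd, hc⟩ := differentiable_and_taylorCoeff_of_hasSum fun z => (hs z).hasSum
    refine ⟨⟨_, hd, ha.congr fun n => ?_⟩, lp.ext (funext fun n => ?_)⟩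
    · rw [hc, ← bargmannWeight_sq hσ, hb, norm_mul, norm_inv, Complex.norm_real,
        Real.norm_of_nonneg (bargmannWeight_pos hσ n).le]
      have := (bargmannWeight_pos hσ n).ne'
      field_simp
    · rw [bargmannToL2ₗ_apply, hc, hb, mul_inv_cancel_left₀ (hne n)]

end bargmann

/-! ### The transform, its uniqueness and its restriction to `EMin` -/

section transform

variable {α σ : ℝ} (hα : 0 < α) (hσ : 0 < σ)

/-- The generalized Segal–Bargmann transform. -/
noncomputable def segalBargmann : Lp ℂ 2 (scaledPoisson α σ) ≃ₗ[ℂ] bargmannSpace σ :=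
  (charlierBasis hα hσ).repr.toLinearEquiv.trans
    (LinearEquiv.ofBijective _ (bargmannToL2ₗ_bijective hσ)).symm

theorem bargmannWeight_mul_taylorCoeff_segalBargmann (g : Lp ℂ 2 (scaledPoisson α σ)) (n : ℕ) :
    bargmannWeight σ n * taylorCoeff (segalBargmann hα hσ g) n =
      (charlierBasis hα hσ).repr g n := by
  rw [← bargmannToL2ₗ_apply hσ]
  exact congrArg (fun b : lp (fun _ : ℕ => ℂ) 2 => b n)
    ((LinearEquiv.ofBijective _ (bargmannToL2ₗ_bijective hσ)).apply_symm_apply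
      ((charlierBasis hα hσ).repr g))

theorem taylorCoeff_pow (m n : ℕ) :
    taylorCoeff (fun z => z ^ n) m = if m = n then 1 else 0 := by
  have := taylorCoeff_polynomial (X ^ n) m
  simpa only [eval_pow, eval_X, coeff_X_pow] using this

theorem charlierLp_apply (n : ℕ) (x : scaledNat α) :
    charlierLp hα hσ n x = (charlier α σ n).eval ((x : ℝ) : ℂ) :=
  EMin.restrict_apply hα hσ _ x

theorem segalBargmann_charlierLp (n : ℕ) (z : ℂ) :
    (segalBargmann hα hσ (charlierLp hα hσ n) : ℂ → ℂ) z = z ^ n := by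
  refine congrFun (eq_of_taylorCoeff_eq (g := fun z => z ^ n) (segalBargmann hα hσ _).2.1
    (differentiable_id.pow n) fun m => ?_) z
  have h1 : (bargmannWeight σ m : ℂ) ≠ 0 := by exact_mod_cast (bargmannWeight_pos hσ m).ne'
  have h2 : (bargmannWeight σ m : ℂ) ^ 2 = m ! * (σ : ℂ) ^ m := by
    exact_mod_cast congrArg Complex.ofReal (bargmannWeight_sq hσ m)
  refine mul_left_cancel₀ h1 ?_
  rw [bargmannWeight_mul_taylorCoeff_segalBargmann, charlierBasis_repr, inner_charlierLp,
    taylorCoeff_pow]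
  split_ifs with hmn
  · subst hmn
    rw [← h2]
    field_simp
  · simp

theorem isSegalBargmann_segalBargmann : IsSegalBargmann α σ (segalBargmann hα hσ) where
  inner_map f g := by
    rw [← inner_eq_integral, ← (charlierBasis hα hσ).repr.inner_map_map, lp.inner_eq_tsum,
      bargmannInner]
    refine tsum_congr fun n => ?_
    have h2 : (bargmannWeight σ n : ℂ) ^ 2 = n ! * (σ : ℂ) ^ n := by
      exact_mod_cast congrArg Complex.ofReal (bargmannWeight_sq hσ n)
    rw [← bargmannWeight_mul_taylorCoeff_segalBargmann,
      ← bargmannWeight_mul_taylorCoeff_segalBargmann, RCLike.inner_apply, map_mul,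
      Complex.conj_ofReal, ← h2]
    ring
  map_orthogonal := ⟨charlier α σ, isMonicOrthogonalSeq_charlier hα hσ, fun n =>
    ⟨charlierLp hα hσ n, (ae_scaledPoisson_iff hα hσ).2 (charlierLp_apply hα hσ n),
      segalBargmann_charlierLp hα hσ n⟩⟩

variable {S : Lp ℂ 2 (scaledPoisson α σ) ≃ₗ[ℂ] bargmannSpace σ}

/-- Pairing `S g` with `S c_n = z^n` isolates one coefficient, and unitarity moves the pairing to
`L²`. The right side does not involve `S`, whence uniqueness. -/
theorem IsSegalBargmann.taylorCoeff_mul (hS : IsSegalBargmann α σ S)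
    (g : Lp ℂ 2 (scaledPoisson α σ)) (n : ℕ) :
    taylorCoeff (S g) n * (n ! * (σ : ℂ) ^ n) = inner ℂ (charlierLp hα hσ n) g := by
  obtain ⟨c, hc, h⟩ := hS.map_orthogonal
  rw [hc.eq_charlier hα hσ] at h
  obtain ⟨p, hp, hSp⟩ := h n
  have hp' : p = charlierLp hα hσ n := Lp.ext (hp.trans
    ((ae_scaledPoisson_iff hα hσ).2 fun x => (charlierLp_apply hα hσ n x).symm))
  rw [inner_eq_integral, ← hp', ← hS.inner_map, bargmannInner]
  have h1 : ((S p : bargmannSpace σ) : ℂ → ℂ) = fun z => z ^ n := funext hSp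
  rw [tsum_eq_single n fun m hm => by rw [h1, taylorCoeff_pow, if_neg hm]; simp, h1,
    taylorCoeff_pow, if_pos rfl, map_one, mul_one]

include hσ in
theorem factorial_mul_pow_ne_zero (n : ℕ) : (n ! * (σ : ℂ) ^ n) ≠ 0 := by
  have h : (n ! * σ ^ n : ℝ) ≠ 0 := by positivity
  exact_mod_cast h

include hα hσ in
theorem IsSegalBargmann.unique {S' : Lp ℂ 2 (scaledPoisson α σ) ≃ₗ[ℂ] bargmannSpace σ}
    (hS : IsSegalBargmann α σ S) (hS' : IsSegalBargmann α σ S') : S = S' := by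
  refine LinearEquiv.ext fun g => Subtype.ext (eq_of_taylorCoeff_eq (S g).2.1 (S' g).2.1
    fun n => mul_right_cancel₀ (factorial_mul_pow_ne_zero hσ n) ?_)
  rw [hS.taylorCoeff_mul hα hσ, hS'.taylorCoeff_mul hα hσ]

/-- For fixed `n`, both `n`-th coefficients, scaled by `n! σ^n`, are continuous linear functionals
of `f`. They agree on Charlier polynomials, hence on all polynomials, hence on `EMin` by density. -/
theorem IsSegalBargmann.restrict_eq (hS : IsSegalBargmann α σ S) (f : EMin) :
    (S (EMin.restrict hα hσ f) : ℂ → ℂ) = (segalBargmannEquiv hα hσ f).1 := by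
  refine eq_of_taylorCoeff_eq (S _).2.1 (EMin.differentiable _)
    fun n => mul_right_cancel₀ (factorial_mul_pow_ne_zero hσ n) ?_
  rw [hS.taylorCoeff_mul hα hσ, mul_comm]
  let A : EMin →L[ℂ] ℂ := (innerSL ℂ (charlierLp hα hσ n)).comp (EMin.restrict hα hσ)
  let B : EMin →L[ℂ] ℂ := (n ! * (σ : ℂ) ^ n) •
    (EMin.coeffL n).comp (segalBargmannEquiv hα hσ).toContinuousLinearMap
  have hAB : A.toLinearMap ∘ₗ EMin.ofPolynomial ∘ₗ polyMap (charlier α σ) =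
      B.toLinearMap ∘ₗ EMin.ofPolynomial ∘ₗ polyMap (charlier α σ) :=
    linearMap_ext_X_pow fun m => by
      have hA : A (EMin.ofPolynomial (charlier α σ m)) =
          inner ℂ (charlierLp hα hσ n) (charlierLp hα hσ m) := rfl
      have hB : B (EMin.ofPolynomial (charlier α σ m)) = (n ! * (σ : ℂ) ^ n) * taylorCoeff
          (segalBargmannEquiv hα hσ (EMin.ofPolynomial (charlier α σ m))).1 n := rfl
      simp only [LinearMap.comp_apply, polyMap_X_pow]
      refine hA.trans (Eq.trans ?_ hB.symm)
      rw [segalBargmannEquiv_ofPolynomial, polyMap_touchard_charlier hα,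
        EMin.taylorCoeff_ofPolynomial, coeff_X_pow, inner_charlierLp]
      split_ifs with hnm
      · rw [hnm, mul_one]
      · rw [mul_zero]
  have hAB' : A = B := EMin.continuousLinearMap_ext fun m => by
    have := LinearMap.congr_fun hAB (polyMap (touchard α σ) (X ^ m))
    simp only [LinearMap.comp_apply, polyMap_charlier_polyMap_touchard hα] at this
    exact this
  exact congrArg (· f) hAB'

/-- Restriction followed by the transform is the automorphism of `EMin`, so no theorem on zeros of
functions of exponential type is needed. -/
theorem EMin.restrict_injective : Function.Injective (restrict (α := α) (σ := σ) hα hσ) :=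
  fun f g hfg => (segalBargmannEquiv hα hσ).injective <| Subtype.ext <| by
    have hS := isSegalBargmann_segalBargmann hα hσ
    rw [← hS.restrict_eq, ← hS.restrict_eq, hfg]

end transform

theorem proposition5p1 (α σ : ℝ) (hα : 0 < α) (hσ : 0 < σ) :
    ∃ ι : EMin →L[ℂ] Lp ℂ 2 (scaledPoisson α σ),
      -- `ι` is restriction of functions to `αℕ₀`, and it is injective
      (∀ f : EMin, ι f =ᵐ[scaledPoisson α σ] fun x => f ((x : ℝ) : ℂ)) ∧
      Function.Injective ι ∧
      -- the transform exists and is unique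
      (∃! S : Lp ℂ 2 (scaledPoisson α σ) ≃ₗ[ℂ] bargmannSpace σ, IsSegalBargmann α σ S) ∧
      -- its restriction is a linear self-homeomorphism
      ∀ S : Lp ℂ 2 (scaledPoisson α σ) ≃ₗ[ℂ] bargmannSpace σ, IsSegalBargmann α σ S →
        ∃ T : EMin ≃L[ℂ] EMin, ∀ (f : EMin) (z : ℂ), (S (ι f) : ℂ → ℂ) z = T f z := by
  refine ⟨EMin.restrict hα hσ,
    fun f => (ae_scaledPoisson_iff hα hσ).2 (EMin.restrict_apply hα hσ f),
    EMin.restrict_injective hα hσ,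
    ⟨segalBargmann hα hσ, isSegalBargmann_segalBargmann hα hσ,
      fun S hS => hS.unique hα hσ (isSegalBargmann_segalBargmann hα hσ)⟩,
    fun S hS => ⟨segalBargmannEquiv hα hσ, fun f z => congrFun (hS.restrict_eq hα hσ f) z⟩⟩
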